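/- **Model.** For $n\ge 1$ let $\Theta=(\rho,\theta,\alpha_1,\dots,\alpha_n,\beta_1,\dots,\beta_n)\in\mathbb R^{2n+2}$ with $\sum_{i}\alpha_i=0$ and $\sum_j\beta_j=0$. In the $p_1$ model with parameter $\Theta$ a random directed graph without loops on $\{1,\dots,n\}$ has a $0/1$ adjacency matrix $(X_{ij})$, $X_{ii}=0$, whose dyads $D_{ij}=(X_{ij},X_{ji})$, $1\le i<j\le n$, are mutually independent, with $$p_{ij}^{ab}:=\mathbb P(D_{ij}=(a,b))=\frac1{k_{ij}}\exp\{a(\theta+\alpha_i+\beta_j)+b(\theta+\alpha_j+\beta_i)+ab\rho\},\qquad a,b\in\{0,1\},$$ where $k_{ij}$ is the normalizing constant making the four probabilities sum to one; $p_{ij}^{ab}$ is given by the same formula for all $i\ne j$. Put $I_{ij}^{ab}=\mathbf 1\{D_{ij}=(a,b)\}$ for $i\ne j$ and, by convention, $I_{ii}^{ab}=0$ and $p_{ii}^{ab}=0$. Sums $\sum_{i,j\ne t}$ run over ordered pairs of distinct $i,j$, both different from $t$ (likewise $\sum_{k,l\ne i,t}$, where $i=t$ is allowed). **Estimators.** $$\hat\theta=\frac1n\sum_{t}\log\frac{\sum_{i,j\ne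 t}I_{it}^{01}I_{ij}^{00}I_{tj}^{01}}{\sum_{i,j\ne t}I_{it}^{00}I_{ij}^{01}I_{tj}^{00}},\qquad \hat\rho=\frac1n\sum_{t}\log\frac{\sum_{i,j\ne t}I_{it}^{11}I_{ij}^{10}I_{tj}^{11}}{\sum_{i,j\ne t}I_{it}^{10}I_{ij}^{11}I_{tj}^{10}}-\hat\theta,$$ $$\hat\alpha_i=\frac1n\sum_{t}\log\frac{\sum_{k,l\ne i,t}I_{ki}^{01}I_{kl}^{00}I_{tl}^{01}}{\sum_{k,l\ne i,t}I_{ki}^{00}I_{kl}^{01}I_{tl}^{00}}-\hat\theta,\qquad \hat\beta_j=\frac1n\sum_{t}\log\frac{\sum_{k,l\ne j,t}I_{kt}^{01}I_{kl}^{00}I_{jl}^{01}}{\sum_{k,l\ne j,t}I_{kt}^{00}I_{kl}^{01}I_{jl}^{00}}-\hat\theta,$$ and $\hat\Theta=(\hat\rho,\hat\theta,\hat\alpha_1,\dots,\hat\alpha_n,\hat\beta_1,\dots,\hat\beta_n)$. **Variance and bias.** For $a,b,c\in\{0,1\}$ and $i\ne t$ let $\mu_t^{(abc)}=\frac1{n^2}\sum_{i,j\ne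 t}p_{it}^{ca}p_{ij}^{cb}p_{tj}^{ca}$, $$\eta_{it}^{(abc)}=\frac1n\sum_{j\ne i,t}\Big(\frac{p_{tj}^{ca}p_{ij}^{cb}}{\mu_t^{(abc)}}+\frac{p_{ji}^{ca}p_{jt}^{cb}}{\mu_i^{(abc)}}-\frac{p_{ij}^{cb}p_{jt}^{cb}}{\mu_j^{(bac)}}\Big),$$ $$\zeta_{it,1}^{(abc)}=\frac1{2n^3}\Big[\Big(\frac1{\mu_t^{(abc)}}\sum_{j\ne t}p_{tj}^{ca}p_{ij}^{cb}\Big)^2+\Big(\frac1{\mu_i^{(abc)}}\sum_{j\ne t}p_{ji}^{ca}p_{jt}^{cb}\Big)^2\Big],$$ $$\zeta_{it,2}^{(abc)}=\frac1{n^3}\Big(\frac1{\mu_t^{(abc)}}\sum_{j\ne t}p_{tj}^{ca}p_{ij}^{cb}\Big)\Big(\frac1{\mu_t^{(abc)}}\sum_{j\ne t}p_{jt}^{ca}p_{ji}^{cb}\Big),$$ and $g_4(x_1,\dots,x_4;y_1,\dots,y_4)=\sum_k x_k^2y_k-(\sum_k x_ky_k)^2$. Define $$\sigma_\rho^2=\frac1{n^4}\sum_{t<i}g_4\Big(-(\eta_{it}^{(100)}+\eta_{ti}^{(011)}),\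 \eta_{it}^{(010)}+\eta_{ti}^{(010)},\ \eta_{it}^{(101)}+\eta_{ti}^{(101)},\ -(\eta_{it}^{(011)}+\eta_{ti}^{(100)});\ p_{it}^{01},p_{it}^{00},p_{it}^{11},p_{it}^{10}\Big),$$ $$\begin{aligned}\rho^*=\frac1{n^2}\sum_{t<i}\Big[&(\zeta_{it,1}^{(100)}+\zeta_{ti,1}^{(011)})p_{it}^{01}(1-p_{it}^{01})+(\zeta_{ti,1}^{(100)}+\zeta_{it,1}^{(011)})p_{it}^{10}(1-p_{it}^{10})\\&-(\zeta_{it,1}^{(101)}+\zeta_{ti,1}^{(101)}+\zeta_{it,2}^{(101)}+\zeta_{ti,2}^{(101)})p_{it}^{11}(1-p_{it}^{11})\\&-(\zeta_{it,1}^{(010)}+\zeta_{ti,1}^{(010)}+\zeta_{it,2}^{(010)}+\zeta_{ti,2}^{(010)})p_{it}^{00}(1-p_{it}^{00})\\&-(\zeta_{it,2}^{(100)}+\zeta_{ti,2}^{(100)}-\zeta_{it,2}^{(011)}-\zeta_{ti,2}^{(011)})p_{it}^{01}p_{it}^{10}\Big].\end{aligned}$$ The plug-in estimates $\hat\sigma_\rho^2$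 and $\hat\rho^*$ are $\sigma_\rho^2$ and $\rho^*$, as functions of $\Theta$, evaluated at $\hat\Theta$. **Lemma.** Let $C>0$ be fixed and suppose $\|\Theta\|_\infty\le C$. Then, as $n\to\infty$: (i) $\hat\sigma_\rho^2/\sigma_\rho^2\to1$ in probability, uniformly in $\Theta$: for all $\varepsilon,\delta>0$ there is $N=N(C,\varepsilon,\delta)$ such that for all $n\ge N$ and all such $\Theta$ one has $\sigma_\rho^2>0$ and, with probability at least $1-\delta$, all numerators and denominators in $\hat\Theta$ are positive and $|\hat\sigma_\rho^2/\sigma_\rho^2-1|\le\varepsilon$. (ii) $\hat\rho^*-\rho^*=O(\sqrt{\log n/n^3})$ with probability at least $1-O(1/n)$: there are $K,K'>0$ and $N$ depending only on $C$ such that for all $n\ge N$ and all such $\Theta$, with probability at least $1-K'/n$, all numerators and denominators in $\hat\Theta$ are positive and $|\hat\rho^*-\rho^*|\le K\sqrt{\log n/n^3}$. -/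

import Mathlib

open MeasureTheory ProbabilityTheory

noncomputable section

namespace P1Model

/-- A parameter vector `Θ = (ρ, θ, α₁, …, αₙ, β₁, …, βₙ)` of the `p₁` model on `n` nodes. -/
structure Param (n : ℕ) where
  rho : ℝ
  theta : ℝ
  alpha : Fin n → ℝ
  beta : Fin n → ℝ

/-- The identification constraints `∑ αᵢ = 0` and `∑ βⱼ = 0`. -/
def Param.Identified {n : ℕ} (Θ : Param n) : Prop :=
  ∑ i, Θ.alpha i = 0 ∧ ∑ j, Θ.beta j = 0

/-- `‖Θ‖_∞ ≤ C`. -/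
def Param.BoundedBy {n : ℕ} (Θ : Param n) (C : ℝ) : Prop :=
  |Θ.rho| ≤ C ∧ |Θ.theta| ≤ C ∧ (∀ i, |Θ.alpha i| ≤ C) ∧ ∀ j, |Θ.beta j| ≤ C

/-- The normalizing constant `k_{ij}`. -/
def normConst {n : ℕ} (Θ : Param n) (i j : Fin n) : ℝ :=
  1 + Real.exp (Θ.theta + Θ.alpha i + Θ.beta j) + Real.exp (Θ.theta + Θ.alpha j + Θ.beta i)
    + Real.exp (Θ.rho + 2 * Θ.theta + Θ.alpha i + Θ.alpha j + Θ.beta i + Θ.beta j)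

/-- The dyad probability `p_{ij}^{ab}`, with the convention `p_{ii}^{ab} = 0` (there are no
dyads on the diagonal). -/
def dyadProb {n : ℕ} (Θ : Param n) (a b : Fin 2) (i j : Fin n) : ℝ :=
  if i = j then 0 else
    Real.exp (((a : ℕ) : ℝ) * (Θ.theta + Θ.alpha i + Θ.beta j)
      + ((b : ℕ) : ℝ) * (Θ.theta + Θ.alpha j + Θ.beta i)
      + ((a : ℕ) : ℝ) * ((b : ℕ) : ℝ) * Θ.rho) / normConst Θ i j

/-- `X` is (the adjacency matrix of) a random directed graph that follows the `p₁` model with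
parameter `Θ` under the probability measure `P`: no loops, mutually independent dyads
`(X_{ij}, X_{ji})`, `i < j`, and each dyad distributed according to `p_{ij}^{ab}`. -/
structure IsRandomGraph {n : ℕ} {Ω : Type*} [MeasurableSpace Ω] (P : Measure Ω)
    (X : Ω → Fin n → Fin n → Fin 2) (Θ : Param n) : Prop where
  measurable : ∀ i j, Measurable fun ω => X ω i j
  no_loops : ∀ ω i, X ω i i = 0
  indep : iIndepFun
    (fun (e : {e : Fin n × Fin n // e.1 < e.2}) (ω : Ω) =>
      (X ω e.1.1 e.1.2, X ω e.1.2 e.1.1)) P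
  law : ∀ i j, i < j → ∀ a b,
    P.real {ω | X ω i j = a ∧ X ω j i = b} = dyadProb Θ a b i j

/-! ### The triple-dyad ratio estimator -/

/-- The dyad indicator `I_{ij}^{ab}`, with `I_{ii}^{ab} = 0`. -/
def dyadInd {n : ℕ} (x : Fin n → Fin n → Fin 2) (a b : Fin 2) (i j : Fin n) : ℝ :=
  if i ≠ j ∧ x i j = a ∧ x j i = b then 1 else 0

/-- `∑_{i,j ≠ t} f i j`, the sum over all ordered pairs of distinct nodes `i, j`, both
different from `t`. -/
def sumPairs {n : ℕ} (t : Fin n) (f : Fin n → Fin n → ℝ) : ℝ :=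
  ∑ i, ∑ j, if i ≠ j ∧ i ≠ t ∧ j ≠ t then f i j else 0

/-- `∑_{i,j ≠ t} I_{it}^{ca} I_{ij}^{cb} I_{tj}^{ca}`. -/
def count {n : ℕ} (x : Fin n → Fin n → Fin 2) (a b c : Fin 2) (t : Fin n) : ℝ :=
  sumPairs t fun i j => dyadInd x c a i t * dyadInd x c b i j * dyadInd x c a t j

/-- `∑_{k,l ≠ i,t} I_{ki}^{ca} I_{kl}^{cb} I_{tl}^{ca}`, the sum over all ordered pairs of
distinct nodes `k, l`, both different from `i` and from `t` (where `i = t` is allowed). -/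
def count₂ {n : ℕ} (x : Fin n → Fin n → Fin 2) (a b c : Fin 2) (i t : Fin n) : ℝ :=
  ∑ k, ∑ l, if k ≠ l ∧ k ≠ i ∧ k ≠ t ∧ l ≠ i ∧ l ≠ t then
    dyadInd x c a k i * dyadInd x c b k l * dyadInd x c a t l else 0

/-- The estimator `θ̂`. -/
def thetaHat {n : ℕ} (x : Fin n → Fin n → Fin 2) : ℝ :=
  1 / (n : ℝ) * ∑ t, Real.log (count x 1 0 0 t / count x 0 1 0 t)

/-- The estimator `ρ̂`. -/
def rhoHat {n : ℕ} (x : Fin n → Fin n → Fin 2) : ℝ :=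
  1 / (n : ℝ) * ∑ t, Real.log (count x 1 0 1 t / count x 0 1 1 t) - thetaHat x

/-- The estimator `α̂ᵢ`. -/
def alphaHat {n : ℕ} (x : Fin n → Fin n → Fin 2) (i : Fin n) : ℝ :=
  1 / (n : ℝ) * ∑ t, Real.log (count₂ x 1 0 0 i t / count₂ x 0 1 0 i t) - thetaHat x

/-- The estimator `β̂ⱼ`. -/
def betaHat {n : ℕ} (x : Fin n → Fin n → Fin 2) (j : Fin n) : ℝ :=
  1 / (n : ℝ) * ∑ t, Real.log (count₂ x 1 0 0 t j / count₂ x 0 1 0 t j) - thetaHat x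

/-- The triple-dyad ratio estimator `Θ̂`. -/
def estimator {n : ℕ} (x : Fin n → Fin n → Fin 2) : Param n where
  rho := rhoHat x
  theta := thetaHat x
  alpha := alphaHat x
  beta := betaHat x

/-- All numerators and denominators in the definition of `Θ̂` are positive, so that all the
quotients and logarithms there are genuinely defined. -/
def EstimatorDefined {n : ℕ} (x : Fin n → Fin n → Fin 2) : Prop :=
  (∀ t, 0 < count x 1 0 0 t ∧ 0 < count x 0 1 0 t ∧ 0 < count x 1 0 1 t ∧ 0 < count x 0 1 1 t) ∧
    ∀ i t, 0 < count₂ x 1 0 0 i t ∧ 0 < count₂ x 0 1 0 i t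

/-! ### The variance `σ_ρ²` and the bias `ρ*` as functions of the parameter -/

/-- `μ_t^{(abc)}`. -/
def mu {n : ℕ} (Θ : Param n) (a b c : Fin 2) (t : Fin n) : ℝ :=
  1 / (n : ℝ) ^ 2 *
    sumPairs t fun i j => dyadProb Θ c a i t * dyadProb Θ c b i j * dyadProb Θ c a t j

/-- `η_{it}^{(abc)}`. -/
def eta {n : ℕ} (Θ : Param n) (a b c : Fin 2) (i t : Fin n) : ℝ :=
  1 / (n : ℝ) * ∑ j ∈ Finset.univ.filter (fun j => j ≠ i ∧ j ≠ t),
    (1 / mu Θ a b c t * (dyadProb Θ c a t j * dyadProb Θ c b i j)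
      + 1 / mu Θ a b c i * (dyadProb Θ c a j i * dyadProb Θ c b j t)
      - 1 / mu Θ b a c j * (dyadProb Θ c b i j * dyadProb Θ c b j t))

/-- `ζ_{it,1}^{(abc)}`. -/
def zeta₁ {n : ℕ} (Θ : Param n) (a b c : Fin 2) (i t : Fin n) : ℝ :=
  1 / (2 * (n : ℝ) ^ 3) *
    ((1 / mu Θ a b c t * ∑ j ∈ Finset.univ.filter (fun j => j ≠ t),
        dyadProb Θ c a t j * dyadProb Θ c b i j) ^ 2
      + (1 / mu Θ a b c i * ∑ j ∈ Finset.univ.filter (fun j => j ≠ t),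
        dyadProb Θ c a j i * dyadProb Θ c b j t) ^ 2)

/-- `ζ_{it,2}^{(abc)}`. -/
def zeta₂ {n : ℕ} (Θ : Param n) (a b c : Fin 2) (i t : Fin n) : ℝ :=
  1 / (n : ℝ) ^ 3 *
    (1 / mu Θ a b c t * ∑ j ∈ Finset.univ.filter (fun j => j ≠ t),
        dyadProb Θ c a t j * dyadProb Θ c b i j) *
    (1 / mu Θ a b c t * ∑ j ∈ Finset.univ.filter (fun j => j ≠ t),
        dyadProb Θ c a j t * dyadProb Θ c b j i)

/-- `g_m(x₁, …, x_m; y₁, …, y_m) = x₁² y₁ + ⋯ + x_m² y_m - (x₁ y₁ + ⋯ + x_m y_m)²`. -/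
def g {m : ℕ} (x y : Fin m → ℝ) : ℝ :=
  ∑ k, x k ^ 2 * y k - (∑ k, x k * y k) ^ 2

/-- The variance `σ_ρ²`. -/
def sigmaRhoSq {n : ℕ} (Θ : Param n) : ℝ :=
  1 / (n : ℝ) ^ 4 * ∑ t : Fin n, ∑ i ∈ Finset.univ.filter (fun i => t < i),
    g ![-(eta Θ 1 0 0 i t + eta Θ 0 1 1 t i),
        eta Θ 0 1 0 i t + eta Θ 0 1 0 t i,
        eta Θ 1 0 1 i t + eta Θ 1 0 1 t i,
        -(eta Θ 0 1 1 i t + eta Θ 1 0 0 t i)]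
      ![dyadProb Θ 0 1 i t, dyadProb Θ 0 0 i t, dyadProb Θ 1 1 i t, dyadProb Θ 1 0 i t]

/-- The bias `ρ*`. -/
def rhoStar {n : ℕ} (Θ : Param n) : ℝ :=
  1 / (n : ℝ) ^ 2 * ∑ t : Fin n, ∑ i ∈ Finset.univ.filter (fun i => t < i),
    ((zeta₁ Θ 1 0 0 i t + zeta₁ Θ 0 1 1 t i) * dyadProb Θ 0 1 i t * (1 - dyadProb Θ 0 1 i t)
      + (zeta₁ Θ 1 0 0 t i + zeta₁ Θ 0 1 1 i t) * dyadProb Θ 1 0 i t * (1 - dyadProb Θ 1 0 i t)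
      - (zeta₁ Θ 1 0 1 i t + zeta₁ Θ 1 0 1 t i + zeta₂ Θ 1 0 1 i t + zeta₂ Θ 1 0 1 t i)
          * dyadProb Θ 1 1 i t * (1 - dyadProb Θ 1 1 i t)
      - (zeta₁ Θ 0 1 0 i t + zeta₁ Θ 0 1 0 t i + zeta₂ Θ 0 1 0 i t + zeta₂ Θ 0 1 0 t i)
          * dyadProb Θ 0 0 i t * (1 - dyadProb Θ 0 0 i t)
      - (zeta₂ Θ 1 0 0 i t + zeta₂ Θ 1 0 0 t i - zeta₂ Θ 0 1 1 i t - zeta₂ Θ 0 1 1 t i)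
          * dyadProb Θ 0 1 i t * dyadProb Θ 1 0 i t)

/-- The plug-in estimate `σ̂_ρ²`. -/
def sigmaRhoSqHat {n : ℕ} (x : Fin n → Fin n → Fin 2) : ℝ := sigmaRhoSq (estimator x)

/-- The plug-in estimate `ρ̂*`. -/
def rhoStarHat {n : ℕ} (x : Fin n → Fin n → Fin 2) : ℝ := rhoStar (estimator x)

end P1Model

end

noncomputable section

/-! The estimator converges to `Θ` in maximum norm at rate `√(log n / n)`, the rescaled functionals
`n² σ_ρ²` and `n ρ*` are Lipschitz in `Θ` with constants independent of `n`, and `n² σ_ρ² ≥ 1`.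
These three facts give both claims.

Rate (`IsRandomGraph.estimator_rate`). In the product of three dyad probabilities that forms the
mean of a numerator, the parameters of the summation indices and the normalizing constants agree
with those in the denominator, up to the factor `exp(cρ + θ + α_i + β_t)`. So the ratio of the means
equals this exponential exactly (`countMean_ratio`), and averaging its logarithm over `t` isolates
the parameters by the identification constraints. The counts have means of order `n²` and, by
Hoeffding applied twice and a union bound, deviate from them by `O(n √(n log n))`.

Lipschitz bounds. Both functionals are built from dyad probabilities by averages, products and
reciprocals of the `μ`, which are bounded away from zero. The relation `Near` passes through all
these operations.

Lower bound (`one_le_sigmaRhoSq`). This is an argument of Cramér–Rao type: up to scaling, `σ_ρ²` is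
a sum over dyads of variances of the linearized estimator, and the covariances of these dyad terms
with the score of `ρ` add up to `n²`. Cauchy–Schwarz in each dyad then bounds the variances below.
-/

namespace P1Model

/-! ### Independence of functions of disjoint groups of variables -/

section Grouping

variable {ι κ Ω β γ : Type*}
  [MeasurableSpace β] [MeasurableSingletonClass β] [Finite β] [MeasurableSpace γ]
  {D : ι → Ω → β}

/-- A set that is determined by finitely many finitely-valued variables is the preimage of a
measurable set under them. -/
lemma exists_preimage_eq_of_determined (S : Finset ι) (A : Set Ω)
    (hA : ∀ ω ω', (∀ e ∈ S, D e ω = D e ω') → ω ∈ A → ω' ∈ A) :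
    ∃ B : Set (S → β), MeasurableSet B ∧ A = (fun ω (e : S) => D e ω) ⁻¹' B := by
  refine ⟨(fun ω (e : S) => D e ω) '' A, (Set.toFinite _).measurableSet, ?_⟩
  ext ω
  constructor
  · intro h
    exact ⟨ω, h, rfl⟩
  · rintro ⟨ω', h', he⟩
    exact hA ω' ω (fun e heS => congrFun he ⟨e, heS⟩) h'

variable [MeasurableSpace Ω] {P : Measure Ω}

lemma measurable_of_determined (hm : ∀ i, Measurable (D i)) (S : Finset ι) (Y : Ω → γ)
    (hY : ∀ ω ω', (∀ e ∈ S, D e ω = D e ω') → Y ω = Y ω') : Measurable Y := by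
  intro B _
  obtain ⟨B', hB', h⟩ := exists_preimage_eq_of_determined (D := D) S (Y ⁻¹' B)
    (fun ω ω' h hω => by simpa [← hY ω ω' h] using hω)
  rw [h]
  exact (measurable_pi_lambda (fun ω (e : S) => D e ω) fun e => hm e) hB'

/-- Functions of disjoint groups of independent finitely-valued variables are independent. -/
lemma iIndepFun_of_determined (hD : iIndepFun D P) (hm : ∀ i, Measurable (D i))
    (S : κ → Finset ι) (hS : Pairwise (Function.onFun Disjoint S)) (Y : κ → Ω → γ)
    (hY : ∀ k ω ω', (∀ e ∈ S k, D e ω = D e ω') → Y k ω = Y k ω') : iIndepFun Y P := by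
  classical
  have := hD.isProbabilityMeasure
  rw [iIndepFun_iff_measure_inter_preimage_eq_mul]
  intro s A hA
  induction s using Finset.induction_on with
  | empty => simp
  | insert k s hk ih =>
    rw [Finset.prod_insert hk, Finset.set_biInter_insert, ← ih fun i hi =>
      hA i (Finset.mem_insert_of_mem hi)]
    obtain ⟨B₁, hB₁, h₁⟩ := exists_preimage_eq_of_determined (D := D) (S k) (Y k ⁻¹' A k)
      (fun ω ω' h hω => by simpa [← hY k ω ω' h] using hω)
    -- The joint event for the indices in `s` depends only on the union of their groups, which is
    -- disjoint from `S k`.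
    obtain ⟨B₂, hB₂, h₂⟩ := exists_preimage_eq_of_determined (D := D) (s.biUnion S)
      (⋂ i ∈ s, Y i ⁻¹' A i) (fun ω ω' h hω => by
        simp only [Set.mem_iInter, Set.mem_preimage] at hω ⊢
        intro i hi
        rw [← hY i ω ω' fun e he => h e (Finset.mem_biUnion.2 ⟨i, hi, he⟩)]
        exact hω i hi)
    have hdisj : Disjoint (S k) (s.biUnion S) := by
      rw [Finset.disjoint_biUnion_right]
      intro i hi
      exact hS (by rintro rfl; exact hk hi)
    have := hD.indepFun_finset (S k) (s.biUnion S) hdisj hm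
    rw [h₁, h₂]
    exact this.measure_inter_preimage_eq_mul _ _ hB₁ hB₂

end Grouping

/-! ### Hoeffding's inequality -/

section Hoeffding

variable {Ω κ : Type*} [MeasurableSpace Ω] {P : Measure Ω} [IsProbabilityMeasure P]

lemma hoeffding_upper {Y : κ → Ω → ℝ} (hY : iIndepFun Y P) (hm : ∀ k, Measurable (Y k))
    (h01 : ∀ k ω, Y k ω ∈ Set.Icc (0 : ℝ) 1) (s : Finset κ) {m ε : ℝ}
    (hs : (s.card : ℝ) ≤ m) (hε : 0 ≤ ε) :
    P.real {ω | ε ≤ ∑ k ∈ s, (Y k ω - ∫ ω', Y k ω' ∂P)} ≤ Real.exp (-(2 * ε ^ 2 / m)) := by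
  have hsub : ∀ k ∈ s, HasSubgaussianMGF (fun ω => Y k ω - ∫ ω', Y k ω' ∂P)
      ((‖(1 : ℝ) - 0‖₊ / 2) ^ 2) P := fun k _ =>
    hasSubgaussianMGF_of_mem_Icc (hm k).aemeasurable (Filter.Eventually.of_forall (h01 k))
  have hind : iIndepFun (fun k ω => Y k ω - ∫ ω', Y k ω' ∂P) P :=
    hY.comp (fun k y => y - ∫ ω', Y k ω' ∂P) fun k => measurable_id.sub_const _
  -- For an empty sum the sub-Gaussian exponent is a division by zero and the bound is the trivial
  -- 1, so this case is separate.
  rcases s.eq_empty_or_nonempty with rfl | hne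
  · rcases hε.eq_or_lt with rfl | hε
    · simp
    · simp [not_le.2 hε, Real.exp_nonneg]
  refine (HasSubgaussianMGF.measure_sum_ge_le_of_iIndepFun hind hsub hε).trans ?_
  have hc : (0 : ℝ) < s.card := by exact_mod_cast hne.card_pos
  rw [Real.exp_le_exp]
  simp only [Finset.sum_const, nsmul_eq_mul]
  push_cast
  simp only [sub_zero, norm_one]
  rw [neg_div, neg_le_neg_iff]
  have : ε ^ 2 / (2 * (s.card * (1 / 2) ^ 2)) = 2 * ε ^ 2 / s.card := by
    field_simp
  rw [this]
  gcongr

/-- Hoeffding's inequality for independent variables with values in `[0, 1]`. -/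
lemma hoeffding_abs {Y : κ → Ω → ℝ} (hY : iIndepFun Y P) (hm : ∀ k, Measurable (Y k))
    (h01 : ∀ k ω, Y k ω ∈ Set.Icc (0 : ℝ) 1) (s : Finset κ) {m ε : ℝ}
    (hs : (s.card : ℝ) ≤ m) (hε : 0 ≤ ε) :
    P.real {ω | ε ≤ |∑ k ∈ s, Y k ω - ∑ k ∈ s, ∫ ω', Y k ω' ∂P|} ≤
      2 * Real.exp (-(2 * ε ^ 2 / m)) := by
  have h1 := hoeffding_upper hY hm h01 s hs hε
  -- The lower tail is the upper tail of `1 - Y`, which again takes values in `[0, 1]`.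
  have hY' : iIndepFun (fun k ω => 1 - Y k ω) P :=
    hY.comp (fun _ y => 1 - y) fun k => measurable_const.sub measurable_id
  have h2 := hoeffding_upper hY' (fun k => measurable_const.sub (hm k))
    (fun k ω => ⟨by linarith [(h01 k ω).2], by linarith [(h01 k ω).1]⟩) s hs hε
  have hint : ∀ k, Integrable (Y k) P := fun k =>
    Integrable.of_mem_Icc 0 1 (hm k).aemeasurable (Filter.Eventually.of_forall (h01 k))
  have hsub : {ω | ε ≤ |∑ k ∈ s, Y k ω - ∑ k ∈ s, ∫ ω', Y k ω' ∂P|} ⊆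
      {ω | ε ≤ ∑ k ∈ s, (Y k ω - ∫ ω', Y k ω' ∂P)} ∪
      {ω | ε ≤ ∑ k ∈ s, ((1 - Y k ω) - ∫ ω', (1 - Y k ω') ∂P)} := by
    intro ω hω
    simp only [Set.mem_union, Set.mem_ofPred_eq] at hω ⊢
    have e : ∀ k, ∫ ω', (1 - Y k ω') ∂P = 1 - ∫ ω', Y k ω' ∂P := fun k => by
      rw [integral_sub (integrable_const _) (hint k)]; simp
    simp only [e, Finset.sum_sub_distrib]
    rcases le_abs.1 hω with h | h
    · left; linarith
    · right; linarith
  refine (measureReal_mono hsub).trans ((measureReal_union_le _ _).trans ?_)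
  linarith

end Hoeffding

end P1Model

/-! ### Independence of the dyads along a star -/

namespace P1Model

section Dyads

variable {n : ℕ}

/-- The potential dyads that join `l` to `k` or to `t`. -/
def starEdges (k t l : Fin n) : Finset {e : Fin n × Fin n // e.1 < e.2} :=
  Finset.univ.filter fun e => l ≠ k ∧ l ≠ t ∧
    ((e.1.1 = l ∧ (e.1.2 = k ∨ e.1.2 = t)) ∨ (e.1.2 = l ∧ (e.1.1 = k ∨ e.1.1 = t)))

/-- Each edge in the set of `l` has exactly one endpoint outside `{k, t}`, namely `l`. The
conditions `l ≠ k, t` are needed: otherwise the edge `{k, t}` would lie in the sets of both `k` and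
`t`. -/
lemma starEdges_disjoint (k t : Fin n) : Pairwise (Function.onFun Disjoint (starEdges k t)) := by
  intro l l' hl
  simp only [Function.onFun, Finset.disjoint_left, starEdges, Finset.mem_filter, Finset.mem_univ,
    true_and]
  grind

lemma dyadInd_nonneg (x : Fin n → Fin n → Fin 2) (a b : Fin 2) (i j : Fin n) :
    0 ≤ dyadInd x a b i j := by unfold dyadInd; split_ifs <;> norm_num

lemma dyadInd_le_one (x : Fin n → Fin n → Fin 2) (a b : Fin 2) (i j : Fin n) :
    dyadInd x a b i j ≤ 1 := by unfold dyadInd; split_ifs <;> norm_num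

lemma dyadInd_swap (x : Fin n → Fin n → Fin 2) (a b : Fin 2) (i j : Fin n) :
    dyadInd x a b i j = dyadInd x b a j i := by
  unfold dyadInd; congr 1; simp only [eq_iff_iff]; tauto

lemma normConst_swap (Θ : Param n) (i j : Fin n) : normConst Θ i j = normConst Θ j i := by
  unfold normConst; ring_nf

lemma dyadProb_swap (Θ : Param n) (a b : Fin 2) (i j : Fin n) :
    dyadProb Θ a b i j = dyadProb Θ b a j i := by
  unfold dyadProb
  rw [normConst_swap]
  by_cases h : i = j
  · simp [h]
  · rw [if_neg h, if_neg (Ne.symm h)]; congr 2; ring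

variable {Ω : Type*} {X : Ω → Fin n → Fin n → Fin 2}

lemma eq_of_starEdges {k t l : Fin n} (hk : l ≠ k) (ht : l ≠ t) {ω ω' : Ω}
    (h : ∀ e ∈ starEdges k t l, (X ω e.1.1 e.1.2, X ω e.1.2 e.1.1) =
      (X ω' e.1.1 e.1.2, X ω' e.1.2 e.1.1)) :
    (X ω k l = X ω' k l ∧ X ω l k = X ω' l k) ∧ (X ω t l = X ω' t l ∧ X ω l t = X ω' l t) := by
  have key : ∀ v, v ≠ l → (v = k ∨ v = t) → X ω v l = X ω' v l ∧ X ω l v = X ω' l v := by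
    intro v hv hvk
    rcases lt_or_gt_of_ne hv with hlt | hlt
    · have := h ⟨(v, l), hlt⟩ (by simp [starEdges, hk, ht, hvk])
      simpa [Prod.ext_iff] using this
    · have := h ⟨(l, v), hlt⟩ (by simp [starEdges, hk, ht, hvk])
      simpa [Prod.ext_iff, and_comm] using this
  exact ⟨key k hk.symm (Or.inl rfl), key t ht.symm (Or.inr rfl)⟩

variable [MeasurableSpace Ω] {P : Measure Ω} {Θ : Param n}

namespace IsRandomGraph

lemma measurable_dyads (hX : IsRandomGraph P X Θ) (e : {e : Fin n × Fin n // e.1 < e.2}) :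
    Measurable fun ω => (X ω e.1.1 e.1.2, X ω e.1.2 e.1.1) :=
  (hX.measurable _ _).prodMk (hX.measurable _ _)

/-- The vanishing hypothesis matches the empty edge sets at `l = k` and `l = t`. The case `k = t` is
allowed and describes a single star. -/
lemma star_iIndepFun (hX : IsRandomGraph P X Θ) (k t : Fin n)
    (Y : Fin n → (Fin n → Fin n → Fin 2) → ℝ) (h0 : ∀ l x, l = k ∨ l = t → Y l x = 0)
    (hY : ∀ l x x', l ≠ k → l ≠ t → x k l = x' k l ∧ x l k = x' l k →
      x t l = x' t l ∧ x l t = x' l t → Y l x = Y l x') :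
    iIndepFun (fun l ω => Y l (X ω)) P ∧ ∀ l, Measurable fun ω => Y l (X ω) := by
  have hdet : ∀ l ω ω', (∀ e ∈ starEdges k t l, (X ω e.1.1 e.1.2, X ω e.1.2 e.1.1) =
      (X ω' e.1.1 e.1.2, X ω' e.1.2 e.1.1)) → Y l (X ω) = Y l (X ω') := by
    intro l ω ω' h
    by_cases hl : l = k ∨ l = t
    · rw [h0 _ _ hl, h0 _ _ hl]
    · push Not at hl
      have := eq_of_starEdges hl.1 hl.2 h
      exact hY l _ _ hl.1 hl.2 this.1 this.2
  exact ⟨iIndepFun_of_determined hX.indep hX.measurable_dyads (starEdges k t)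
      (starEdges_disjoint k t) _ hdet,
    fun l => measurable_of_determined hX.measurable_dyads (starEdges k t l) _ (hdet l)⟩

lemma measurable_dyadInd (hX : IsRandomGraph P X Θ) (a b : Fin 2) (i j : Fin n) :
    Measurable fun ω => dyadInd (X ω) a b i j := by
  unfold dyadInd
  refine Measurable.ite ?_ measurable_const measurable_const
  by_cases h : i = j
  · simp [h]
  · simp only [ne_eq, h, not_false_eq_true, true_and]
    exact (hX.measurable i j (measurableSet_singleton a)).inter
      (hX.measurable j i (measurableSet_singleton b))

lemma integral_dyadInd (hX : IsRandomGraph P X Θ) (a b : Fin 2) (i j : Fin n) :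
    ∫ ω, dyadInd (X ω) a b i j ∂P = dyadProb Θ a b i j := by
  have main : ∀ (a b : Fin 2) (i j : Fin n), i < j →
      ∫ ω, dyadInd (X ω) a b i j ∂P = dyadProb Θ a b i j := by
    intro a b i j hij
    rw [← hX.law i j hij a b, ← integral_indicator_one]
    · congr 1
      ext ω
      simp [dyadInd, Set.indicator, hij.ne]
    · exact (hX.measurable i j (measurableSet_singleton a)).inter
        (hX.measurable j i (measurableSet_singleton b))
  rcases lt_trichotomy i j with h | h | h
  · exact main a b i j h
  · simp [h, dyadInd, dyadProb]
  · rw [dyadProb_swap, ← main b a j i h]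
    simp_rw [dyadInd_swap _ a b i j]

lemma integral_dyadInd_mul (hX : IsRandomGraph P X Θ) (a b a' b' : Fin 2) {k t l : Fin n}
    (hkt : k ≠ t) (hk : l ≠ k) (ht : l ≠ t) :
    ∫ ω, dyadInd (X ω) a b k l * dyadInd (X ω) a' b' t l ∂P =
      dyadProb Θ a b k l * dyadProb Θ a' b' t l := by
  -- The two dyads are edges of the single star centred at `l`, with leaves `k` and `t`.
  have h := (hX.star_iIndepFun l l (fun v x => if v = l then 0 else if v = k then
    dyadInd x a b v l else dyadInd x a' b' v l) (by simp +contextual)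
    (by
      intro v x x' hv _ h1 _
      simp only [hv, if_false, dyadInd, h1.1, h1.2])).1.indepFun hkt
  simp only [hk.symm, ht.symm, if_false, if_true, hkt.symm] at h
  rw [h.integral_fun_mul_eq_mul_integral
    (hX.measurable_dyadInd _ _ _ _).aestronglyMeasurable
    (hX.measurable_dyadInd _ _ _ _).aestronglyMeasurable,
    hX.integral_dyadInd, hX.integral_dyadInd]

variable [IsProbabilityMeasure P]

lemma star_hoeffding (hX : IsRandomGraph P X Θ) (k t : Fin n) (s : Finset (Fin n))
    (hks : k ∉ s) (hts : t ∉ s)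
    (Y : Fin n → (Fin n → Fin n → Fin 2) → ℝ) (h01 : ∀ l x, Y l x ∈ Set.Icc (0 : ℝ) 1)
    (hY : ∀ l x x', l ≠ k → l ≠ t → x k l = x' k l ∧ x l k = x' l k →
      x t l = x' t l ∧ x l t = x' l t → Y l x = Y l x') {ε : ℝ} (hε : 0 ≤ ε) :
    P.real {ω | ε ≤ |∑ l ∈ s, Y l (X ω) - ∑ l ∈ s, ∫ ω', Y l (X ω') ∂P|} ≤
      2 * Real.exp (-(2 * ε ^ 2 / n)) := by
  obtain ⟨hi, hm⟩ := hX.star_iIndepFun k t (fun l x => if l ∈ s then Y l x else 0)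
    (by rintro l x (rfl | rfl) <;> simp [hks, hts])
    (by
      intro l x x' h1 h2 h3 h4
      simp only [hY l x x' h1 h2 h3 h4])
  have := hoeffding_abs hi hm
    (fun l ω => by
      by_cases h : l ∈ s
      · simpa [h] using h01 l (X ω)
      · simp [h]) s (m := n)
    (by simpa using s.card_le_univ) hε
  convert this using 6 with ω
  congr 1
  · exact Finset.sum_congr rfl fun l hl => by simp [hl]
  · exact Finset.sum_congr rfl fun l hl => by simp [hl]

end IsRandomGraph

end Dyads

end P1Model

/-! ### Concentration of the triple-dyad counts -/

namespace P1Model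

variable {n : ℕ}

lemma dyadProb_nonneg (Θ : Param n) (a b : Fin 2) (i j : Fin n) : 0 ≤ dyadProb Θ a b i j := by
  unfold dyadProb normConst
  split_ifs
  · exact le_rfl
  · positivity

lemma dyadProb_le_one (Θ : Param n) (a b : Fin 2) (i j : Fin n) : dyadProb Θ a b i j ≤ 1 := by
  unfold dyadProb
  split_ifs
  · exact zero_le_one
  · have h1 := Real.exp_pos (Θ.theta + Θ.alpha i + Θ.beta j)
    have h2 := Real.exp_pos (Θ.theta + Θ.alpha j + Θ.beta i)
    have h3 := Real.exp_pos
      (Θ.rho + 2 * Θ.theta + Θ.alpha i + Θ.alpha j + Θ.beta i + Θ.beta j)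
    have hk : 0 < normConst Θ i j := by unfold normConst; positivity
    rw [div_le_one hk]
    unfold normConst
    fin_cases a <;> fin_cases b <;> simp
    · linarith
    · linarith
    · linarith
    · rw [show Θ.theta + Θ.alpha i + Θ.beta j + (Θ.theta + Θ.alpha j + Θ.beta i) + Θ.rho =
        Θ.rho + 2 * Θ.theta + Θ.alpha i + Θ.alpha j + Θ.beta i + Θ.beta j by ring]
      linarith

/-- The sum `∑_{k,l ≠ i,t} p_{ki}^{ca} p_{kl}^{cb} p_{tl}^{ca}`, the mean of `count₂`. -/
def countMean (Θ : Param n) (a b c : Fin 2) (i t : Fin n) : ℝ :=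
  ∑ k, ∑ l, if k ≠ l ∧ k ≠ i ∧ k ≠ t ∧ l ≠ i ∧ l ≠ t then
    dyadProb Θ c a k i * dyadProb Θ c b k l * dyadProb Θ c a t l else 0

/-- In this nested form the inner terms, for fixed `k`, involve disjoint sets of dyads, and so do
the outer factors `u k i`. -/
lemma triple_sum_eq (i t : Fin n) (u v w : Fin n → Fin n → ℝ) :
    (∑ k, ∑ l, if k ≠ l ∧ k ≠ i ∧ k ≠ t ∧ l ≠ i ∧ l ≠ t then u k i * v k l * w t l else 0) =
      ∑ k ∈ Finset.univ.filter (fun k => k ≠ i ∧ k ≠ t), u k i *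
        ∑ l ∈ Finset.univ.filter (fun l => l ≠ k ∧ l ≠ i ∧ l ≠ t), v k l * w t l := by
  rw [Finset.sum_filter]
  refine Finset.sum_congr rfl fun k _ => ?_
  split_ifs with h
  · rw [Finset.mul_sum, Finset.sum_filter]
    refine Finset.sum_congr rfl fun l _ => ?_
    by_cases hl : l ≠ k ∧ l ≠ i ∧ l ≠ t
    · rw [if_pos ⟨hl.1.symm, h.1, h.2, hl.2⟩, if_pos hl]; ring
    · rw [if_neg (by tauto), if_neg hl]
  · exact Finset.sum_eq_zero fun l _ => if_neg (by tauto)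

variable {Ω : Type*} [MeasurableSpace Ω] {P : Measure Ω} [IsProbabilityMeasure P]
  {X : Ω → Fin n → Fin n → Fin 2} {Θ : Param n}

namespace IsRandomGraph

/-- The inner sums are first replaced by their means `s k`, by Hoeffding for each `k`; Hoeffding
then applies to the outer sum with the deterministic weights `s k`. Each stage costs `nε`. No
independence between the stages is used, so the shared dyads when `i = t` do no harm. -/
lemma count₂_concentration (hX : IsRandomGraph P X Θ) (a b c : Fin 2) (i t : Fin n)
    {ε : ℝ} (hε : 0 ≤ ε) :
    P.real {ω | 2 * n * ε < |count₂ (X ω) a b c i t - countMean Θ a b c i t|} ≤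
      (n + 1) * (2 * Real.exp (-(2 * ε ^ 2 / n))) := by
  have hn : (0 : ℝ) < n := by exact_mod_cast i.pos
  set U : Finset (Fin n) := Finset.univ.filter fun k => k ≠ i ∧ k ≠ t with hU
  set V : Fin n → Finset (Fin n) := fun k =>
    Finset.univ.filter fun l => l ≠ k ∧ l ≠ i ∧ l ≠ t with hV
  set S : Ω → Fin n → ℝ := fun ω k =>
    ∑ l ∈ V k, dyadInd (X ω) c b k l * dyadInd (X ω) c a t l with hS
  set s : Fin n → ℝ := fun k => ∑ l ∈ V k, dyadProb Θ c b k l * dyadProb Θ c a t l with hs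
  have hcard : ∀ A : Finset (Fin n), (A.card : ℝ) ≤ n := fun A => by
    exact_mod_cast (by simpa using A.card_le_univ)
  have hs0 : ∀ k, 0 ≤ s k := fun k => Finset.sum_nonneg fun l _ =>
    mul_nonneg (dyadProb_nonneg _ _ _ _ _) (dyadProb_nonneg _ _ _ _ _)
  have hsn : ∀ k, s k ≤ n := fun k => by
    refine (Finset.sum_le_card_nsmul _ _ 1 fun l _ => ?_).trans (by simpa using hcard (V k))
    exact mul_le_one₀ (dyadProb_le_one _ _ _ _ _) (dyadProb_nonneg _ _ _ _ _)
      (dyadProb_le_one _ _ _ _ _)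
  have hB1 : ∀ k ∈ U, P.real {ω | ε ≤ |S ω k - s k|} ≤
      2 * Real.exp (-(2 * ε ^ 2 / n)) := by
    intro k hk
    have hkt : k ≠ t := (Finset.mem_filter.1 hk).2.2
    have := hX.star_hoeffding k t (V k) (by simp [hV]) (by simp [hV])
      (fun l x => dyadInd x c b k l * dyadInd x c a t l)
      (fun l x => ⟨mul_nonneg (dyadInd_nonneg _ _ _ _ _) (dyadInd_nonneg _ _ _ _ _),
        mul_le_one₀ (dyadInd_le_one _ _ _ _ _) (dyadInd_nonneg _ _ _ _ _)
          (dyadInd_le_one _ _ _ _ _)⟩)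
      (by
        intro l x x' _ _ h1 h2
        simp only [dyadInd, h1.1, h1.2, h2.1, h2.2]) hε
    have e : ∑ l ∈ V k, ∫ ω', dyadInd (X ω') c b k l * dyadInd (X ω') c a t l ∂P = s k :=
      Finset.sum_congr rfl fun l hl => by
        have hl' := (Finset.mem_filter.1 hl).2
        exact hX.integral_dyadInd_mul _ _ _ _ hkt hl'.1 hl'.2.2
    rwa [e] at this
  -- Since `s k ≤ n`, division by `n` brings the weighted terms into `[0, 1]`.
  have hB2 : P.real {ω | ε ≤ |∑ k ∈ U, dyadInd (X ω) c a k i * (s k / n) -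
      ∑ k ∈ U, dyadProb Θ c a k i * (s k / n)|} ≤ 2 * Real.exp (-(2 * ε ^ 2 / n)) := by
    have := hX.star_hoeffding i i U (by simp [hU]) (by simp [hU])
      (fun k x => dyadInd x c a k i * (s k / n))
      (fun k x => ⟨mul_nonneg (dyadInd_nonneg _ _ _ _ _) (div_nonneg (hs0 k) hn.le),
        mul_le_one₀ (dyadInd_le_one _ _ _ _ _) (div_nonneg (hs0 k) hn.le)
          ((div_le_one hn).2 (hsn k))⟩)
      (by
        intro l x x' _ _ h1 _
        simp only [dyadInd, h1.1, h1.2]) hε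
    have e : ∀ k, ∫ ω', dyadInd (X ω') c a k i * (s k / n) ∂P =
        dyadProb Θ c a k i * (s k / n) := fun k => by
      rw [integral_mul_const, hX.integral_dyadInd]
    simpa only [e] using this
  have hsub : {ω | 2 * n * ε < |count₂ (X ω) a b c i t - countMean Θ a b c i t|} ⊆
      (⋃ k ∈ U, {ω | ε ≤ |S ω k - s k|}) ∪
      {ω | ε ≤ |∑ k ∈ U, dyadInd (X ω) c a k i * (s k / n) -
        ∑ k ∈ U, dyadProb Θ c a k i * (s k / n)|} := by
    intro ω hω
    by_contra hcon
    simp only [Set.mem_union, Set.mem_iUnion, Set.mem_ofPred_eq, not_or, not_exists, not_le]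
      at hcon hω
    obtain ⟨h1, h2⟩ := hcon
    have ec : count₂ (X ω) a b c i t = ∑ k ∈ U, dyadInd (X ω) c a k i * S ω k :=
      triple_sum_eq i t (dyadInd (X ω) c a) (dyadInd (X ω) c b) (dyadInd (X ω) c a)
    have em : countMean Θ a b c i t = ∑ k ∈ U, dyadProb Θ c a k i * s k :=
      triple_sum_eq i t (dyadProb Θ c a) (dyadProb Θ c b) (dyadProb Θ c a)
    have e3 : count₂ (X ω) a b c i t - countMean Θ a b c i t =
        ∑ k ∈ U, dyadInd (X ω) c a k i * (S ω k - s k) +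
        n * (∑ k ∈ U, dyadInd (X ω) c a k i * (s k / n) -
          ∑ k ∈ U, dyadProb Θ c a k i * (s k / n)) := by
      rw [ec, em, mul_sub, Finset.mul_sum, Finset.mul_sum, add_sub, ← Finset.sum_add_distrib]
      congr 1
      · exact Finset.sum_congr rfl fun k _ => by field_simp; ring
      · exact Finset.sum_congr rfl fun k _ => by field_simp
    have b1 : |∑ k ∈ U, dyadInd (X ω) c a k i * (S ω k - s k)| ≤ n * ε := by
      refine (Finset.abs_sum_le_sum_abs _ _).trans
        ((Finset.sum_le_card_nsmul _ _ ε fun k hk => ?_).trans ?_)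
      · rw [abs_mul, abs_of_nonneg (dyadInd_nonneg _ _ _ _ _)]
        exact (mul_le_of_le_one_left (abs_nonneg _) (dyadInd_le_one _ _ _ _ _)).trans (h1 k hk).le
      · rw [nsmul_eq_mul]
        exact mul_le_mul_of_nonneg_right (hcard U) hε
    have b2 := mul_le_mul_of_nonneg_left h2.le hn.le
    rw [e3] at hω
    have b3 := abs_add_le (∑ k ∈ U, dyadInd (X ω) c a k i * (S ω k - s k))
      (n * (∑ k ∈ U, dyadInd (X ω) c a k i * (s k / n) -
          ∑ k ∈ U, dyadProb Θ c a k i * (s k / n)))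
    rw [abs_mul, abs_of_pos hn] at b3
    linarith
  refine (measureReal_mono hsub).trans ((measureReal_union_le _ _).trans ?_)
  rw [add_mul, one_mul]
  refine add_le_add ((measureReal_biUnion_finset_le _ _).trans
    ((Finset.sum_le_card_nsmul _ _ _ hB1).trans ?_)) hB2
  rw [nsmul_eq_mul]
  exact mul_le_mul_of_nonneg_right (hcard U) (by positivity)

/-- With high probability, all triple-dyad counts are close to their means. -/
lemma count₂_concentration_uniform (hX : IsRandomGraph P X Θ) (hn : 1 ≤ n) :
    1 - 32 / (n : ℝ) ≤ P.real {ω | ∀ a b c i t, |count₂ (X ω) a b c i t - countMean Θ a b c i t| ≤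
      2 * n * √(2 * n * Real.log n)} := by
  have hn0 : (0 : ℝ) < n := by exact_mod_cast hn
  have hn1 : (1 : ℝ) ≤ n := by exact_mod_cast hn
  -- With this `ε` the exponential is `n⁻⁴`, and the union bound over `8n²` index tuples gives
  -- `16(n+1)/n² ≤ 32/n`.
  set ε := √(2 * n * Real.log n) with hε
  set S := {ω | ∀ a b c i t, |count₂ (X ω) a b c i t - countMean Θ a b c i t| ≤ 2 * n * ε}
  have hlog : 0 ≤ Real.log n := Real.log_nonneg hn1
  have hexp : Real.exp (-(2 * ε ^ 2 / n)) = 1 / (n : ℝ) ^ 4 := by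
    rw [hε, Real.sq_sqrt (by positivity),
      show 2 * (2 * n * Real.log n) / n = ((4 : ℕ) : ℝ) * Real.log n by push_cast; field_simp; ring,
      Real.exp_neg, Real.exp_nat_mul, Real.exp_log hn0, one_div]
  have hsub : Sᶜ ⊆ ⋃ q : (Fin 2 × Fin 2 × Fin 2) × (Fin n × Fin n),
      {ω | 2 * n * ε < |count₂ (X ω) q.1.1 q.1.2.1 q.1.2.2 q.2.1 q.2.2 -
        countMean Θ q.1.1 q.1.2.1 q.1.2.2 q.2.1 q.2.2|} := by
    intro ω hω
    simp only [S, Set.mem_compl_iff, Set.mem_ofPred_eq, not_forall, not_le] at hω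
    obtain ⟨a, b, c, i, t, h⟩ := hω
    exact Set.mem_iUnion.2 ⟨((a, b, c), (i, t)), h⟩
  have hbound : P.real Sᶜ ≤ 32 / n := by
    refine (measureReal_mono hsub).trans ((measureReal_iUnion_fintype_le _).trans
      ((Finset.sum_le_sum fun q _ => hX.count₂_concentration _ _ _ _ _
        (Real.sqrt_nonneg _)).trans ?_))
    rw [Finset.sum_const, nsmul_eq_mul, ← hε, hexp]
    simp only [Finset.card_univ, Fintype.card_prod, Fintype.card_fin]
    norm_num only [Nat.cast_mul, Nat.cast_ofNat]
    rw [show (8 * ((n : ℝ) * n)) * ((n + 1) * (2 * (1 / (n : ℝ) ^ 4))) =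
      16 * (n + 1) / n / n by field_simp; ring]
    gcongr
    rw [div_le_iff₀ hn0]
    linarith
  have hone : 1 ≤ P.real S + P.real Sᶜ := by
    have := measureReal_union_le (μ := P) S Sᶜ
    rwa [Set.union_compl_self, probReal_univ] at this
  linarith

end IsRandomGraph

end P1Model

/-! ### Rate of convergence of the estimator -/

namespace P1Model

variable {n : ℕ}

/-- A lower bound for the dyad probabilities of a parameter bounded by `C`. -/
def minProb (C : ℝ) : ℝ := Real.exp (-(7 * C)) / (4 * Real.exp (7 * C))

lemma minProb_pos (C : ℝ) : 0 < minProb C := by unfold minProb; positivity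

lemma Param.BoundedBy.nonneg {Θ : Param n} {C : ℝ} (hΘ : Θ.BoundedBy C) : 0 ≤ C :=
  (abs_nonneg _).trans hΘ.1

/-- Every exponent is a sum of at most seven parameters, `θ` counted twice, and the normalizing
constant has four terms. -/
lemma minProb_le_dyadProb {Θ : Param n} {C : ℝ} (hΘ : Θ.BoundedBy C) (a b : Fin 2) {i j : Fin n}
    (hij : i ≠ j) : minProb C ≤ dyadProb Θ a b i j := by
  have hC := hΘ.nonneg
  obtain ⟨h1, h2, h3, h4⟩ := hΘ
  have r := abs_le.1 h1
  have th := abs_le.1 h2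
  have ai := abs_le.1 (h3 i)
  have aj := abs_le.1 (h3 j)
  have bi := abs_le.1 (h4 i)
  have bj := abs_le.1 (h4 j)
  have hk : 0 < normConst Θ i j := by unfold normConst; positivity
  unfold dyadProb minProb
  rw [if_neg hij]
  refine div_le_div₀ (Real.exp_pos _).le ?_ hk ?_
  · rw [Real.exp_le_exp]
    fin_cases a <;> fin_cases b <;> simp <;> linarith
  · have e0 : 1 ≤ Real.exp (7 * C) := Real.one_le_exp (by linarith)
    have e1 : Real.exp (Θ.theta + Θ.alpha i + Θ.beta j) ≤ Real.exp (7 * C) := by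
      rw [Real.exp_le_exp]; linarith
    have e2 : Real.exp (Θ.theta + Θ.alpha j + Θ.beta i) ≤ Real.exp (7 * C) := by
      rw [Real.exp_le_exp]; linarith
    have e3 : Real.exp (Θ.rho + 2 * Θ.theta + Θ.alpha i + Θ.alpha j + Θ.beta i + Θ.beta j) ≤
      Real.exp (7 * C) := by
      rw [Real.exp_le_exp]; linarith
    unfold normConst
    linarith

lemma half_le_card_filter (hn : 6 ≤ n) (k i t : Fin n) :
    (n : ℝ) / 2 ≤ ((Finset.univ.filter fun l => l ≠ k ∧ l ≠ i ∧ l ≠ t).card : ℝ) := by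
  have h1 : (Finset.univ.filter fun l => l ≠ k ∧ l ≠ i ∧ l ≠ t) = ({k, i, t} : Finset (Fin n))ᶜ := by
    ext l; simp
  have h2 : ({k, i, t} : Finset (Fin n)).card ≤ 3 := Finset.card_le_three
  rw [h1, Finset.card_compl, Fintype.card_fin, Nat.cast_sub (h2.trans (by omega))]
  have h2' : (({k, i, t} : Finset (Fin n)).card : ℝ) ≤ 3 := by exact_mod_cast h2
  have hn' : (6 : ℝ) ≤ n := by exact_mod_cast hn
  linarith

lemma countMean_ge {Θ : Param n} {C : ℝ} (hΘ : Θ.BoundedBy C) (hn : 6 ≤ n) (a b c : Fin 2)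
    (i t : Fin n) : minProb C ^ 3 / 4 * (n : ℝ) ^ 2 ≤ countMean Θ a b c i t := by
  have hm := minProb_pos C
  unfold countMean
  rw [triple_sum_eq i t (dyadProb Θ c a) (dyadProb Θ c b) (dyadProb Θ c a)]
  have inner : ∀ k, k ≠ t → (n : ℝ) / 2 * minProb C ^ 2 ≤
      ∑ l ∈ Finset.univ.filter (fun l => l ≠ k ∧ l ≠ i ∧ l ≠ t),
        dyadProb Θ c b k l * dyadProb Θ c a t l := by
    intro k _
    refine (mul_le_mul_of_nonneg_right (half_le_card_filter hn k i t) (sq_nonneg _)).trans ?_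
    rw [← nsmul_eq_mul]
    refine Finset.card_nsmul_le_sum _ _ _ fun l hl => ?_
    have hl' := (Finset.mem_filter.1 hl).2
    rw [sq]
    exact mul_le_mul (minProb_le_dyadProb hΘ _ _ hl'.1.symm)
      (minProb_le_dyadProb hΘ _ _ hl'.2.2.symm) hm.le (dyadProb_nonneg _ _ _ _ _)
  have hcard : (n : ℝ) / 2 ≤ ((Finset.univ.filter fun k => k ≠ i ∧ k ≠ t).card : ℝ) := by
    refine (half_le_card_filter hn i i t).trans ?_
    simp
  calc minProb C ^ 3 / 4 * (n : ℝ) ^ 2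
      = (n : ℝ) / 2 * (minProb C * ((n : ℝ) / 2 * minProb C ^ 2)) := by ring
    _ ≤ ((Finset.univ.filter fun k => k ≠ i ∧ k ≠ t).card : ℝ) *
        (minProb C * ((n : ℝ) / 2 * minProb C ^ 2)) := by gcongr
    _ ≤ _ := by
      rw [← nsmul_eq_mul]
      refine Finset.card_nsmul_le_sum _ _ _ fun k hk => ?_
      have hk' := (Finset.mem_filter.1 hk).2
      exact mul_le_mul (minProb_le_dyadProb hΘ _ _ hk'.1) (inner k hk'.2) (by positivity)
        (dyadProb_nonneg _ _ _ _ _)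

/-- The cross ratio identity behind the estimator: the reciprocal edge has been cancelled. -/
lemma dyadProb_triple_ratio (Θ : Param n) (c : Fin 2) (i t k l : Fin n) :
    dyadProb Θ c 1 k i * dyadProb Θ c 0 k l * dyadProb Θ c 1 t l =
      Real.exp (((c : ℕ) : ℝ) * Θ.rho + Θ.theta + Θ.alpha i + Θ.beta t) *
        (dyadProb Θ c 0 k i * dyadProb Θ c 1 k l * dyadProb Θ c 0 t l) := by
  unfold dyadProb
  by_cases h1 : k = i
  · simp [h1]
  by_cases h2 : k = l
  · simp [h2]
  by_cases h3 : t = l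
  · simp [h3]
  simp only [h1, h2, h3, if_false]
  have : ∀ x y z x' y' z' w d e f : ℝ, x + y + z = w + (x' + y' + z') →
      Real.exp x / d * (Real.exp y / e) * (Real.exp z / f) =
        Real.exp w * (Real.exp x' / d * (Real.exp y' / e) * (Real.exp z' / f)) := by
    intro x y z x' y' z' w d e f h
    have := congrArg Real.exp h
    simp only [Real.exp_add] at this
    simp only [div_eq_mul_inv]
    linear_combination (d⁻¹ * e⁻¹ * f⁻¹) * this
  apply this
  simp
  ring

lemma countMean_ratio (Θ : Param n) (c : Fin 2) (i t : Fin n) :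
    countMean Θ 1 0 c i t =
      Real.exp (((c : ℕ) : ℝ) * Θ.rho + Θ.theta + Θ.alpha i + Θ.beta t) *
        countMean Θ 0 1 c i t := by
  unfold countMean
  simp only [Finset.mul_sum, mul_ite, mul_zero, dyadProb_triple_ratio Θ c i t]

lemma count_eq_count₂ (x : Fin n → Fin n → Fin 2) (a b c : Fin 2) (t : Fin n) :
    count x a b c t = count₂ x a b c t t := by
  unfold count count₂ sumPairs
  refine Finset.sum_congr rfl fun k _ => Finset.sum_congr rfl fun l _ => ?_
  congr 1
  simp only [eq_iff_iff]
  tauto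

lemma mu_eq_countMean (Θ : Param n) (a b c : Fin 2) (t : Fin n) :
    mu Θ a b c t = 1 / (n : ℝ) ^ 2 * countMean Θ a b c t t := by
  unfold mu countMean sumPairs
  congr 1
  refine Finset.sum_congr rfl fun k _ => Finset.sum_congr rfl fun l _ => ?_
  congr 1
  simp only [eq_iff_iff]
  tauto

lemma mu_ge {Θ : Param n} {C : ℝ} (hΘ : Θ.BoundedBy C) (hn : 6 ≤ n) (a b c : Fin 2)
    (t : Fin n) : minProb C ^ 3 / 4 ≤ mu Θ a b c t := by
  have hn0 : (0 : ℝ) < n := by exact_mod_cast (by omega : 0 < n)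
  rw [mu_eq_countMean, one_div, inv_mul_eq_div, le_div_iff₀ (by positivity)]
  exact countMean_ge hΘ hn a b c t t

/-- Uses `1 - 1/x ≤ log x ≤ x - 1` at `x = N/E`, and `1/(1 - δ) ≤ 1 + 2δ` for `δ ≤ 1/2`. -/
lemma log_close {N E δ : ℝ} (hE : 0 < E) (hδ : δ ≤ 1 / 2) (h : |N - E| ≤ δ * E) :
    0 < N ∧ |Real.log N - Real.log E| ≤ 2 * δ := by
  have h' := abs_le.1 h
  have hδ0 : 0 ≤ δ := by
    by_contra hc
    have := abs_nonneg (N - E)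
    nlinarith
  have hN : 0 < N := by nlinarith
  refine ⟨hN, ?_⟩
  rw [← Real.log_div hN.ne' hE.ne', abs_le]
  have hx : 0 < N / E := by positivity
  have u := Real.log_le_sub_one_of_pos hx
  have l := Real.one_sub_inv_le_log_of_pos hx
  constructor
  · refine le_trans ?_ l
    rw [inv_div]
    have : E / N ≤ 1 + 2 * δ := by
      rw [div_le_iff₀ hN]
      nlinarith [mul_nonneg hδ0 hE.le]
    linarith
  · have : N / E ≤ 1 + δ := by
      rw [div_le_iff₀ hE]
      linarith
    linarith

lemma log_ratio_close {x : Fin n → Fin n → Fin 2} {Θ : Param n} {δ : ℝ} (hδ : δ ≤ 1 / 2)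
    (hpos : ∀ a b c i t, 0 < countMean Θ a b c i t)
    (h : ∀ a b c i t, |count₂ x a b c i t - countMean Θ a b c i t| ≤ δ * countMean Θ a b c i t)
    (c : Fin 2) (i t : Fin n) :
    |Real.log (count₂ x 1 0 c i t / count₂ x 0 1 c i t) -
      (((c : ℕ) : ℝ) * Θ.rho + Θ.theta + Θ.alpha i + Θ.beta t)| ≤ 4 * δ := by
  obtain ⟨p1, l1⟩ := log_close (hpos 1 0 c i t) hδ (h 1 0 c i t)
  obtain ⟨p2, l2⟩ := log_close (hpos 0 1 c i t) hδ (h 0 1 c i t)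
  rw [countMean_ratio, Real.log_mul (Real.exp_pos _).ne' (hpos 0 1 c i t).ne',
    Real.log_exp] at l1
  rw [Real.log_div p1.ne' p2.ne']
  rw [abs_le] at *
  constructor <;> linarith [l1.1, l1.2, l2.1, l2.2]

lemma average_close (hn : 0 < n) {f f' : Fin n → ℝ} {m δ : ℝ} (h : ∀ t, |f t - f' t| ≤ δ)
    (hf' : ∑ t, f' t = n * m) : |1 / (n : ℝ) * ∑ t, f t - m| ≤ δ := by
  have hn0 : (0 : ℝ) < n := by exact_mod_cast hn
  have : 1 / (n : ℝ) * ∑ t, f t - m = (∑ t, (f t - f' t)) / n := by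
    rw [Finset.sum_sub_distrib, hf']; field_simp
  rw [this, abs_div, abs_of_pos hn0, div_le_iff₀ hn0]
  refine (Finset.abs_sum_le_sum_abs _ _).trans
    ((Finset.sum_le_card_nsmul _ _ δ fun t _ => h t).trans ?_)
  simp [mul_comm]

/-- `‖Θ' - Θ‖_∞ ≤ r`. -/
def Param.Close (Θ Θ' : Param n) (r : ℝ) : Prop :=
  |Θ.rho - Θ'.rho| ≤ r ∧ |Θ.theta - Θ'.theta| ≤ r ∧ (∀ i, |Θ.alpha i - Θ'.alpha i| ≤ r) ∧
    ∀ j, |Θ.beta j - Θ'.beta j| ≤ r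

lemma Param.Close.boundedBy {Θ Θ' : Param n} {C r : ℝ} (h : Θ'.Close Θ r) (hΘ : Θ.BoundedBy C) :
    Θ'.BoundedBy (C + r) := by
  have key : ∀ u v : ℝ, |u - v| ≤ r → |v| ≤ C → |u| ≤ C + r := fun u v h1 h2 => by
    have := abs_sub_abs_le_abs_sub u v
    linarith
  exact ⟨key _ _ h.1 hΘ.1, key _ _ h.2.1 hΘ.2.1, fun i => key _ _ (h.2.2.1 i) (hΘ.2.2.1 i),
    fun j => key _ _ (h.2.2.2 j) (hΘ.2.2.2 j)⟩

/-- Averaging over `t` removes the terms `α_t` and `β_t` because they sum to zero. Each averaged log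
ratio has error `4δ`; subtracting `θ̂` adds another `4δ`. -/
lemma estimator_close {x : Fin n → Fin n → Fin 2} {Θ : Param n} (hn : 0 < n)
    (hid : Θ.Identified) {δ : ℝ} (hδ : δ ≤ 1 / 2)
    (hpos : ∀ a b c i t, 0 < countMean Θ a b c i t)
    (h : ∀ a b c i t, |count₂ x a b c i t - countMean Θ a b c i t| ≤ δ * countMean Θ a b c i t) :
    EstimatorDefined x ∧ (estimator x).Close Θ (8 * δ) := by
  have hcount : ∀ a b c i t, 0 < count₂ x a b c i t := fun a b c i t =>
    (log_close (hpos a b c i t) hδ (h a b c i t)).1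
  have hratio := log_ratio_close hδ hpos h
  have hδ0 : 0 ≤ 4 * δ := (abs_nonneg _).trans (hratio 0 ⟨0, hn⟩ ⟨0, hn⟩)
  have hθ : |thetaHat x - Θ.theta| ≤ 4 * δ := by
    unfold thetaHat
    simp only [count_eq_count₂]
    refine average_close hn (fun t => hratio 0 t t) ?_
    simp [Finset.sum_add_distrib, hid.1, hid.2]
  have hρ : |1 / (n : ℝ) * ∑ t, Real.log (count x 1 0 1 t / count x 0 1 1 t) -
      (Θ.rho + Θ.theta)| ≤ 4 * δ := by
    simp only [count_eq_count₂]
    refine average_close hn (fun t => hratio 1 t t) ?_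
    simp [Finset.sum_add_distrib, hid.1, hid.2, mul_add]
  have hα : ∀ i, |1 / (n : ℝ) * ∑ t, Real.log (count₂ x 1 0 0 i t / count₂ x 0 1 0 i t) -
      (Θ.theta + Θ.alpha i)| ≤ 4 * δ := fun i => by
    refine average_close hn (fun t => hratio 0 i t) ?_
    simp [Finset.sum_add_distrib, hid.2, mul_add]
  have hβ : ∀ j, |1 / (n : ℝ) * ∑ t, Real.log (count₂ x 1 0 0 t j / count₂ x 0 1 0 t j) -
      (Θ.theta + Θ.beta j)| ≤ 4 * δ := fun j => by
    refine average_close hn (fun t => hratio 0 t j) ?_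
    simp [Finset.sum_add_distrib, hid.1, mul_add]
  have comb : ∀ u v w z : ℝ, |u - (v + w)| ≤ 4 * δ → |z - v| ≤ 4 * δ → |u - z - w| ≤ 8 * δ := by
    intro u v w z h1 h2
    rw [abs_le] at *
    constructor <;> linarith [h1.1, h1.2, h2.1, h2.2]
  refine ⟨⟨fun t => by simp only [count_eq_count₂]; exact ⟨hcount _ _ _ _ _, hcount _ _ _ _ _,
    hcount _ _ _ _ _, hcount _ _ _ _ _⟩, fun i t => ⟨hcount _ _ _ _ _, hcount _ _ _ _ _⟩⟩, ?_⟩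
  refine ⟨comb _ _ _ _ (by rwa [add_comm] at hρ) hθ, hθ.trans (by linarith),
    fun i => comb _ _ _ _ (hα i) hθ, fun j => comb _ _ _ _ (hβ j) hθ⟩

/-- The constant in the rate of convergence of the estimator. -/
def rateConst (C : ℝ) : ℝ := 96 / minProb C ^ 3

lemma rateConst_pos (C : ℝ) : 0 < rateConst C := by
  have := minProb_pos C
  unfold rateConst; positivity

/-- The estimator converges at rate `√(log n / n)` in the maximum norm. -/
lemma IsRandomGraph.estimator_rate {Ω : Type*} [MeasurableSpace Ω] {P : Measure Ω}
    [IsProbabilityMeasure P] {X : Ω → Fin n → Fin n → Fin 2} {Θ : Param n}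
    (hX : IsRandomGraph P X Θ) (hn : 6 ≤ n) {C : ℝ} (hid : Θ.Identified) (hΘ : Θ.BoundedBy C)
    (hrate : rateConst C * √(Real.log n / n) ≤ 1) :
    1 - 32 / (n : ℝ) ≤ P.real {ω | EstimatorDefined (X ω) ∧
      (estimator (X ω)).Close Θ (rateConst C * √(Real.log n / n))} := by
  have hn0 : (0 : ℝ) < n := by exact_mod_cast (by omega : 0 < n)
  have hm := minProb_pos C
  have hlog : 0 ≤ Real.log n := Real.log_nonneg (by exact_mod_cast (by omega : 1 ≤ n))
  refine (hX.count₂_concentration_uniform (by omega)).trans (measureReal_mono fun ω hω => ?_)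
  simp only [Set.mem_ofPred_eq] at hω ⊢
  have key := estimator_close (x := X ω) (by omega) hid
    (δ := rateConst C * √(Real.log n / n) / 8) (by linarith)
    (fun a b c i t => lt_of_lt_of_le (by positivity) (countMean_ge hΘ hn a b c i t)) ?_
  · rwa [mul_div_cancel₀ _ (by norm_num : (8 : ℝ) ≠ 0)] at key
  · intro a b c i t
    refine (hω a b c i t).trans (le_trans ?_ (mul_le_mul_of_nonneg_left
      (countMean_ge hΘ hn a b c i t) (div_nonneg (mul_nonneg (rateConst_pos C).le
        (Real.sqrt_nonneg _)) (by norm_num))))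
    -- Here `3/2` replaces `√2`. The deviation is then at most `3n² √(log n / n)`, and `96 = 3 · 4 ·
    -- 8` absorbs the `1/4` in the lower bound for the mean and the `8` of `estimator_close`.
    have hsq : √(2 * n * Real.log n) ≤ 3 / 2 * n * √(Real.log n / n) := by
      rw [Real.sqrt_le_left (by positivity), mul_pow, Real.sq_sqrt (by positivity)]
      have : (3 / 2 * (n : ℝ)) ^ 2 * (Real.log n / n) = 9 / 4 * n * Real.log n := by
        field_simp; ring
      rw [this]
      have := mul_nonneg hn0.le hlog
      nlinarith
    calc 2 * n * √(2 * n * Real.log n) ≤ 2 * n * (3 / 2 * n * √(Real.log n / n)) := by gcongr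
      _ = rateConst C * √(Real.log n / n) / 8 * (minProb C ^ 3 / 4 * (n : ℝ) ^ 2) := by
        unfold rateConst
        field_simp
        ring

end P1Model

/-! ### Uniform Lipschitz bounds for the variance and the bias -/

namespace P1Model

/-- `u` and `v` are bounded by `B` and differ by at most `B * r`. -/
def Near (B r u v : ℝ) : Prop := 0 ≤ r ∧ |u| ≤ B ∧ |v| ≤ B ∧ |u - v| ≤ B * r

namespace Near

variable {B B' r u v u' v' : ℝ}

lemma const_nonneg (h : Near B r u v) : 0 ≤ B := (abs_nonneg _).trans h.2.1

lemma mono (h : Near B r u v) (hB : B ≤ B') : Near B' r u v :=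
  ⟨h.1, h.2.1.trans hB, h.2.2.1.trans hB, h.2.2.2.trans (mul_le_mul_of_nonneg_right hB h.1)⟩

lemma const (hr : 0 ≤ r) (hu : |u| ≤ B) : Near B r u u :=
  ⟨hr, hu, hu, by simpa using mul_nonneg ((abs_nonneg _).trans hu) hr⟩

lemma ite (h : Near B r u v) (p : Prop) [Decidable p] :
    Near B r (if p then u else 0) (if p then v else 0) := by
  split_ifs
  · exact h
  · exact const h.1 (by simpa using h.const_nonneg)

lemma neg (h : Near B r u v) : Near B r (-u) (-v) := by
  obtain ⟨h0, h1, h2, h3⟩ := h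
  refine ⟨h0, by rwa [abs_neg], by rwa [abs_neg], ?_⟩
  rwa [← abs_neg, show -(-u - -v) = u - v by ring]

lemma add (h : Near B r u v) (h' : Near B' r u' v') : Near (B + B') r (u + u') (v + v') := by
  refine ⟨h.1, (abs_add_le _ _).trans (add_le_add h.2.1 h'.2.1),
    (abs_add_le _ _).trans (add_le_add h.2.2.1 h'.2.2.1), ?_⟩
  rw [show u + u' - (v + v') = (u - v) + (u' - v') by ring, add_mul]
  exact (abs_add_le _ _).trans (add_le_add h.2.2.2 h'.2.2.2)

lemma sub (h : Near B r u v) (h' : Near B' r u' v') : Near (B + B') r (u - u') (v - v') := by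
  simpa [sub_eq_add_neg] using h.add h'.neg

/-- The factor 2 comes from the two terms of the product rule. -/
lemma mul (h : Near B r u v) (h' : Near B' r u' v') : Near (2 * B * B') r (u * u') (v * v') := by
  have hB := h.const_nonneg
  have hB' := h'.const_nonneg
  have hBB := mul_nonneg hB hB'
  refine ⟨h.1, ?_, ?_, ?_⟩
  · rw [abs_mul]
    linarith [mul_le_mul h.2.1 h'.2.1 (abs_nonneg _) hB]
  · rw [abs_mul]
    linarith [mul_le_mul h.2.2.1 h'.2.2.1 (abs_nonneg _) hB]
  · rw [show u * u' - v * v' = u * (u' - v') + (u - v) * v' by ring]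
    refine (abs_add_le _ _).trans ?_
    rw [abs_mul, abs_mul]
    have e1 := mul_le_mul h.2.1 h'.2.2.2 (abs_nonneg _) hB
    have e2 := mul_le_mul h.2.2.2 h'.2.2.1 (abs_nonneg _) (mul_nonneg hB h.1)
    linarith

lemma sq (h : Near B r u v) : Near (2 * B * B) r (u ^ 2) (v ^ 2) := by
  simpa only [pow_two] using h.mul h

lemma one_div {c : ℝ} (h : Near B r u v) (hc : 0 < c) (hu : c ≤ u) (hv : c ≤ v) :
    Near (1 / c + B / c ^ 2) r (1 / u) (1 / v) := by
  have hB := h.const_nonneg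
  have hu0 := hc.trans_le hu
  have hv0 := hc.trans_le hv
  have hBc : 0 ≤ B / c ^ 2 := by positivity
  have hr := h.1
  have hc1 : 0 ≤ 1 / c := by positivity
  refine ⟨h.1, ?_, ?_, ?_⟩
  · rw [abs_of_pos (by positivity)]
    linarith [one_div_le_one_div_of_le hc hu]
  · rw [abs_of_pos (by positivity)]
    linarith [one_div_le_one_div_of_le hc hv]
  · have e : 1 / u - 1 / v = -(u - v) / (u * v) := by field_simp; ring
    rw [e, abs_div, abs_neg, abs_of_pos (mul_pos hu0 hv0)]
    have : |u - v| / (u * v) ≤ B * r / (c ^ 2) := by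
      have h3 := h.2.2.2
      have : c ^ 2 ≤ u * v := by rw [pow_two]; exact mul_le_mul hu hv hc.le hu0.le
      gcongr
    rw [add_mul]
    have e2 : B / c ^ 2 * r = B * r / c ^ 2 := by ring
    linarith [mul_nonneg hc1 hr]

lemma exp (h : Near B r u v) : Near (Real.exp B * (B + 1)) r (Real.exp u) (Real.exp v) := by
  have hB := h.const_nonneg
  have hE := Real.exp_pos B
  have key : ∀ x y, |x| ≤ B → |x - y| ≤ B * r → Real.exp x - Real.exp y ≤
      Real.exp B * (B * r) := by
    intro x y hx hxy
    have h1 : Real.exp y = Real.exp x * Real.exp (y - x) := by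
      rw [← Real.exp_add]; congr 1; ring
    have h2 := Real.add_one_le_exp (y - x)
    have h3 := Real.exp_pos x
    have h4 : Real.exp x ≤ Real.exp B := Real.exp_le_exp.2 ((le_abs_self _).trans hx)
    have h5 := le_abs_self (x - y)
    calc Real.exp x - Real.exp y ≤ Real.exp x * (x - y) := by
          rw [h1]; nlinarith
      _ ≤ Real.exp x * (B * r) := by gcongr; linarith
      _ ≤ _ := mul_le_mul_of_nonneg_right h4 (mul_nonneg hB h.1)
  have bd : ∀ x, |x| ≤ B → |Real.exp x| ≤ Real.exp B * (B + 1) := by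
    intro x hx
    rw [abs_of_pos (Real.exp_pos _)]
    have : Real.exp x ≤ Real.exp B := Real.exp_le_exp.2 ((le_abs_self _).trans hx)
    nlinarith
  refine ⟨h.1, bd _ h.2.1, bd _ h.2.2.1, ?_⟩
  have k1 := key u v h.2.1 h.2.2.2
  have k2 := key v u h.2.2.1 (by rw [abs_sub_comm]; exact h.2.2.2)
  have := mul_nonneg hE.le h.1
  rw [abs_le]
  constructor <;> nlinarith

/-- At most `n` terms are divided by `n`, so the constant does not grow; this keeps all later bounds
uniform in `n`. -/
lemma average {n : ℕ} (hn : 0 < n) {f f' : Fin n → ℝ} (h : ∀ j, Near B r (f j) (f' j))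
    (s : Finset (Fin n)) : Near B r (1 / (n : ℝ) * ∑ j ∈ s, f j) (1 / (n : ℝ) * ∑ j ∈ s, f' j) := by
  have hn0 : (0 : ℝ) < n := by exact_mod_cast hn
  have key : ∀ (g : Fin n → ℝ) (M : ℝ), (∀ j, |g j| ≤ M) → |1 / (n : ℝ) * ∑ j ∈ s, g j| ≤ M := by
    intro g M hg
    have hM : 0 ≤ M := (abs_nonneg _).trans (hg ⟨0, hn⟩)
    rw [abs_mul, abs_of_pos (by positivity : (0 : ℝ) < 1 / n), one_div_mul_eq_div, div_le_iff₀ hn0]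
    refine (Finset.abs_sum_le_sum_abs _ _).trans
      ((Finset.sum_le_card_nsmul _ _ M fun j _ => hg j).trans ?_)
    rw [nsmul_eq_mul, mul_comm]
    gcongr
    simpa using s.card_le_univ
  refine ⟨(h ⟨0, hn⟩).1, key _ _ fun j => (h j).2.1, key _ _ fun j => (h j).2.2.1, ?_⟩
  rw [← mul_sub, ← Finset.sum_sub_distrib]
  exact key _ _ fun j => (h j).2.2.2

end Near

/-- Two parameters bounded by `C` whose distance is at most `r`. -/
structure Comparable {n : ℕ} (C r : ℝ) (Θ Θ' : Param n) : Prop where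
  size : 6 ≤ n
  nonneg : 0 ≤ r
  left : Θ.BoundedBy C
  right : Θ'.BoundedBy C
  close : Θ.Close Θ' r

lemma near_of_close {C r u v : ℝ} (hr : 0 ≤ r) (hu : |u| ≤ C) (hv : |v| ≤ C) (h : |u - v| ≤ r) :
    Near (C + 1) r u v := by
  have hC := (abs_nonneg _).trans hu
  refine ⟨hr, by linarith, by linarith, ?_⟩
  nlinarith

lemma exists_near_dyadProb (C : ℝ) : ∃ B, ∀ (n : ℕ) (r : ℝ) (Θ Θ' : Param n), Comparable C r Θ Θ' →
    ∀ a b i j, Near B r (dyadProb Θ a b i j) (dyadProb Θ' a b i j) := by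
  -- The constant stays a metavariable, to be read off from the final `Near` term. It is created
  -- before `n`, `r` and the parameters are introduced, so it cannot depend on them.
  apply Exists.intro
  intro n r Θ Θ' h a b i j
  have hρ := near_of_close h.nonneg h.left.1 h.right.1 h.close.1
  have hθ := near_of_close h.nonneg h.left.2.1 h.right.2.1 h.close.2.1
  have hα := fun i => near_of_close h.nonneg (h.left.2.2.1 i) (h.right.2.2.1 i) (h.close.2.2.1 i)
  have hβ := fun i => near_of_close h.nonneg (h.left.2.2.2 i) (h.right.2.2.2 i) (h.close.2.2.2 i)
  have hbit : ∀ a : Fin 2, Near 1 r ((a : ℕ) : ℝ) ((a : ℕ) : ℝ) := fun a =>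
    Near.const h.nonneg (by fin_cases a <;> simp)
  have h2 : Near 2 r 2 2 := Near.const h.nonneg (by norm_num)
  have h1 : Near 1 r 1 1 := Near.const h.nonneg (by norm_num)
  have hk : Near _ r (normConst Θ i j) (normConst Θ' i j) :=
    ((h1.add ((hθ.add (hα i)).add (hβ j)).exp).add ((hθ.add (hα j)).add (hβ i)).exp).add
      (((((hρ.add (h2.mul hθ)).add (hα i)).add (hα j)).add (hβ i)).add (hβ j)).exp
  have hk1 : ∀ Θ : Param n, 1 ≤ normConst Θ i j := fun Θ => by
    unfold normConst
    have e1 := Real.exp_pos (Θ.theta + Θ.alpha i + Θ.beta j)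
    have e2 := Real.exp_pos (Θ.theta + Θ.alpha j + Θ.beta i)
    have e3 := Real.exp_pos (Θ.rho + 2 * Θ.theta + Θ.alpha i + Θ.alpha j + Θ.beta i + Θ.beta j)
    linarith
  have hnum := ((((hbit a).mul ((hθ.add (hα i)).add (hβ j))).add
    ((hbit b).mul ((hθ.add (hα j)).add (hβ i)))).add
      (((hbit a).mul (hbit b)).mul hρ)).exp.mul (hk.one_div one_pos (hk1 Θ) (hk1 Θ'))
  by_cases hij : i ≠ j
  · simp only [dyadProb, if_neg hij]
    simp only [mul_one_div] at hnum
    exact hnum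
  · simp only [dyadProb, if_pos (not_not.1 hij)]
    exact Near.const h.nonneg (by simpa using hnum.const_nonneg)

lemma exists_near_mu (C : ℝ) : ∃ B, ∀ (n : ℕ) (r : ℝ) (Θ Θ' : Param n), Comparable C r Θ Θ' →
    ∀ a b c t, Near B r (1 / mu Θ a b c t) (1 / mu Θ' a b c t) := by
  obtain ⟨Bp, hp⟩ := exists_near_dyadProb C
  apply Exists.intro
  intro n r Θ Θ' h a b c t
  have hp := hp n r Θ Θ' h
  have hn : 0 < n := by have := h.size; omega
  have hc : 0 < minProb C ^ 3 / 4 := by have := minProb_pos C; positivity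
  have e : ∀ Θ : Param n, mu Θ a b c t = 1 / (n : ℝ) * ∑ i, 1 / (n : ℝ) * ∑ j,
      if i ≠ j ∧ i ≠ t ∧ j ≠ t then dyadProb Θ c a i t * dyadProb Θ c b i j * dyadProb Θ c a t j
      else 0 := fun Θ => by
    unfold mu sumPairs
    rw [← Finset.mul_sum]
    ring
  have hm := Near.average hn (fun i => Near.average hn (fun j =>
    (((hp c a i t).mul (hp c b i j)).mul (hp c a t j)).ite (i ≠ j ∧ i ≠ t ∧ j ≠ t))
      Finset.univ) Finset.univ
  rw [← e, ← e] at hm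
  exact hm.one_div hc (mu_ge h.left h.size a b c t) (mu_ge h.right h.size a b c t)

lemma exists_near_eta (C : ℝ) : ∃ B, ∀ (n : ℕ) (r : ℝ) (Θ Θ' : Param n), Comparable C r Θ Θ' →
    ∀ a b c i t, Near B r (eta Θ a b c i t) (eta Θ' a b c i t) := by
  obtain ⟨Bp, hp⟩ := exists_near_dyadProb C
  obtain ⟨Bm, hm⟩ := exists_near_mu C
  apply Exists.intro
  intro n r Θ Θ' h a b c i t
  have hp := hp n r Θ Θ' h
  have hm := hm n r Θ Θ' h
  have hn : 0 < n := by have := h.size; omega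
  exact Near.average hn (fun j => (((hm a b c t).mul ((hp c a t j).mul (hp c b i j))).add
    ((hm a b c i).mul ((hp c a j i).mul (hp c b j t)))).sub
    ((hm b a c j).mul ((hp c b i j).mul (hp c b j t)))) _

/-- The squared sums are of order `n²` against the prefactor `n⁻³`; multiplying by `n` turns each
sum into an average. -/
lemma exists_near_zeta₁ (C : ℝ) : ∃ B, ∀ (n : ℕ) (r : ℝ) (Θ Θ' : Param n), Comparable C r Θ Θ' →
    ∀ a b c i t, Near B r (n * zeta₁ Θ a b c i t) (n * zeta₁ Θ' a b c i t) := by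
  obtain ⟨Bp, hp⟩ := exists_near_dyadProb C
  obtain ⟨Bm, hm⟩ := exists_near_mu C
  apply Exists.intro
  intro n r Θ Θ' h a b c i t
  have hp := hp n r Θ Θ' h
  have hm := hm n r Θ Θ' h
  have hn : 0 < n := by have := h.size; omega
  have hn0 : (n : ℝ) ≠ 0 := by exact_mod_cast hn.ne'
  have e : ∀ m S m' S' : ℝ, n * (1 / (2 * (n : ℝ) ^ 3) * ((m * S) ^ 2 + (m' * S') ^ 2)) =
      1 / 2 * ((m * (1 / (n : ℝ) * S)) ^ 2 + (m' * (1 / (n : ℝ) * S')) ^ 2) := by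
    intro m S m' S'
    field_simp
  unfold zeta₁
  rw [e, e]
  have half : Near (1 / 2) r (1 / 2) (1 / 2) := Near.const h.nonneg (by norm_num)
  exact half.mul (((hm a b c t).mul (Near.average hn
    (fun j => (hp c a t j).mul (hp c b i j)) _)).sq.add
    ((hm a b c i).mul (Near.average hn (fun j => (hp c a j i).mul (hp c b j t)) _)).sq)

lemma exists_near_zeta₂ (C : ℝ) : ∃ B, ∀ (n : ℕ) (r : ℝ) (Θ Θ' : Param n), Comparable C r Θ Θ' →
    ∀ a b c i t, Near B r (n * zeta₂ Θ a b c i t) (n * zeta₂ Θ' a b c i t) := by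
  obtain ⟨Bp, hp⟩ := exists_near_dyadProb C
  obtain ⟨Bm, hm⟩ := exists_near_mu C
  apply Exists.intro
  intro n r Θ Θ' h a b c i t
  have hp := hp n r Θ Θ' h
  have hm := hm n r Θ Θ' h
  have hn : 0 < n := by have := h.size; omega
  have hn0 : (n : ℝ) ≠ 0 := by exact_mod_cast hn.ne'
  have e : ∀ m S S' : ℝ, n * (1 / (n : ℝ) ^ 3 * (m * S) * (m * S')) =
      (m * (1 / (n : ℝ) * S)) * (m * (1 / (n : ℝ) * S')) := by
    intro m S S'
    field_simp
  unfold zeta₂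
  rw [e, e]
  exact ((hm a b c t).mul (Near.average hn (fun j => (hp c a t j).mul (hp c b i j)) _)).mul
    ((hm a b c t).mul (Near.average hn (fun j => (hp c a j t).mul (hp c b j i)) _))

/-- The rescaled variance `n² σ_ρ²` is uniformly Lipschitz in the parameter. -/
lemma exists_near_sigmaRhoSq (C : ℝ) : ∃ B, ∀ (n : ℕ) (r : ℝ) (Θ Θ' : Param n),
    Comparable C r Θ Θ' → Near B r ((n : ℝ) ^ 2 * sigmaRhoSq Θ) ((n : ℝ) ^ 2 * sigmaRhoSq Θ') := by
  obtain ⟨Bp, hp⟩ := exists_near_dyadProb C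
  obtain ⟨Be, he⟩ := exists_near_eta C
  apply Exists.intro
  intro n r Θ Θ' h
  have hp := hp n r Θ Θ' h
  have he := he n r Θ Θ' h
  have hn : 0 < n := by have := h.size; omega
  have hn0 : (n : ℝ) ≠ 0 := by exact_mod_cast hn.ne'
  have e : ∀ f : Fin n → Fin n → ℝ, (n : ℝ) ^ 2 * (1 / (n : ℝ) ^ 4 *
      ∑ t : Fin n, ∑ i ∈ Finset.univ.filter (fun i => t < i), f t i) =
      1 / (n : ℝ) * ∑ t : Fin n, 1 / (n : ℝ) * ∑ i ∈ Finset.univ.filter (fun i => t < i), f t i := by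
    intro f
    rw [← Finset.mul_sum]
    field_simp
  unfold sigmaRhoSq
  rw [e, e]
  simp only [g, Fin.sum_univ_four]
  have x1 := fun t i => ((he 1 0 0 i t).add (he 0 1 1 t i)).neg
  have x2 := fun t i => (he 0 1 0 i t).add (he 0 1 0 t i)
  have x3 := fun t i => (he 1 0 1 i t).add (he 1 0 1 t i)
  have x4 := fun t i => ((he 0 1 1 i t).add (he 1 0 0 t i)).neg
  have y1 := hp 0 1
  have y2 := hp 0 0
  have y3 := hp 1 1
  have y4 := hp 1 0
  exact Near.average hn (fun t => Near.average hn (fun i =>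
    (((((x1 t i).sq.mul (y1 i t)).add ((x2 t i).sq.mul (y2 i t))).add
      ((x3 t i).sq.mul (y3 i t))).add ((x4 t i).sq.mul (y4 i t))).sub
    (((((x1 t i).mul (y1 i t)).add ((x2 t i).mul (y2 i t))).add
      ((x3 t i).mul (y3 i t))).add ((x4 t i).mul (y4 i t))).sq) _) _

/-- The rescaled bias `n ρ*` is uniformly Lipschitz in the parameter. -/
lemma exists_near_rhoStar (C : ℝ) : ∃ B, ∀ (n : ℕ) (r : ℝ) (Θ Θ' : Param n),
    Comparable C r Θ Θ' → Near B r (n * rhoStar Θ) (n * rhoStar Θ') := by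
  obtain ⟨Bp, hp⟩ := exists_near_dyadProb C
  obtain ⟨B₁, h₁⟩ := exists_near_zeta₁ C
  obtain ⟨B₂, h₂⟩ := exists_near_zeta₂ C
  apply Exists.intro
  intro n r Θ Θ' h
  have hp := hp n r Θ Θ' h
  have h₁ := h₁ n r Θ Θ' h
  have h₂ := h₂ n r Θ Θ' h
  have hn : 0 < n := by have := h.size; omega
  have hn0 : (n : ℝ) ≠ 0 := by exact_mod_cast hn.ne'
  have e : ∀ f : Fin n → Fin n → ℝ, (n : ℝ) * (1 / (n : ℝ) ^ 2 *
      ∑ t : Fin n, ∑ i ∈ Finset.univ.filter (fun i => t < i), f t i) =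
      1 / (n : ℝ) * ∑ t : Fin n, 1 / (n : ℝ) *
        ∑ i ∈ Finset.univ.filter (fun i => t < i), n * f t i := by
    intro f
    simp only [← Finset.mul_sum]
    field_simp
  have e' : ∀ z1 z2 z3 z4 z5 z6 z7 z8 z9 z10 z11 z12 z13 z14 z15 z16 p1 p2 p3 p4 : ℝ,
      n * ((z1 + z2) * p1 * (1 - p1) + (z3 + z4) * p2 * (1 - p2)
        - (z5 + z6 + z7 + z8) * p3 * (1 - p3) - (z9 + z10 + z11 + z12) * p4 * (1 - p4)
        - (z13 + z14 - z15 - z16) * p1 * p2) =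
      (n * z1 + n * z2) * p1 * (1 - p1) + (n * z3 + n * z4) * p2 * (1 - p2)
        - (n * z5 + n * z6 + n * z7 + n * z8) * p3 * (1 - p3)
        - (n * z9 + n * z10 + n * z11 + n * z12) * p4 * (1 - p4)
        - (n * z13 + n * z14 - n * z15 - n * z16) * p1 * p2 := by
    intros; ring
  unfold rhoStar
  rw [e, e]
  simp only [e']
  have one : Near 1 r 1 1 := Near.const h.nonneg (by norm_num)
  have p1 := hp 0 1
  have p2 := hp 1 0
  have p3 := hp 1 1
  have p4 := hp 0 0
  exact Near.average hn (fun t => Near.average hn (fun i =>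
    (((((((h₁ 1 0 0 i t).add (h₁ 0 1 1 t i)).mul (p1 i t)).mul (one.sub (p1 i t))).add
    ((((h₁ 1 0 0 t i).add (h₁ 0 1 1 i t)).mul (p2 i t)).mul (one.sub (p2 i t)))).sub
    ((((((h₁ 1 0 1 i t).add (h₁ 1 0 1 t i)).add (h₂ 1 0 1 i t)).add (h₂ 1 0 1 t i)).mul
      (p3 i t)).mul (one.sub (p3 i t)))).sub
    ((((((h₁ 0 1 0 i t).add (h₁ 0 1 0 t i)).add (h₂ 0 1 0 i t)).add (h₂ 0 1 0 t i)).mul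
      (p4 i t)).mul (one.sub (p4 i t)))).sub
    ((((((h₂ 1 0 0 i t).add (h₂ 1 0 0 t i)).sub (h₂ 0 1 1 i t)).sub (h₂ 0 1 1 t i)).mul
      (p1 i t)).mul (p2 i t))) _) _

end P1Model

/-! ### Lower bound for the variance -/

namespace P1Model

variable {n : ℕ}

lemma dyadProb_self (Θ : Param n) (a b : Fin 2) (i : Fin n) : dyadProb Θ a b i i = 0 := by
  simp [dyadProb]

lemma sum_dyadProb (Θ : Param n) {i j : Fin n} (hij : i ≠ j) :
    dyadProb Θ 0 1 i j + dyadProb Θ 0 0 i j + dyadProb Θ 1 1 i j + dyadProb Θ 1 0 i j = 1 := by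
  have hk : 0 < normConst Θ i j := by unfold normConst; positivity
  simp only [dyadProb, if_neg hij]
  rw [← add_div, ← add_div, ← add_div, div_eq_one_iff_eq hk.ne', normConst]
  simp
  rw [show Θ.theta + Θ.alpha i + Θ.beta j + (Θ.theta + Θ.alpha j + Θ.beta i) + Θ.rho =
        Θ.rho + 2 * Θ.theta + Θ.alpha i + Θ.alpha j + Θ.beta i + Θ.beta j by ring]
  ring

lemma mu_eq_sum (Θ : Param n) (a b c : Fin 2) (t : Fin n) :
    mu Θ a b c t = 1 / (n : ℝ) ^ 2 *
      ∑ i, ∑ j, dyadProb Θ c a i t * dyadProb Θ c b i j * dyadProb Θ c a t j := by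
  unfold mu sumPairs
  congr 1
  refine Finset.sum_congr rfl fun i _ => Finset.sum_congr rfl fun j _ => ?_
  split_ifs with h
  · rfl
  · by_cases h1 : i = j
    · simp [h1, dyadProb_self]
    by_cases h2 : i = t
    · simp [h2, dyadProb_self]
    by_cases h3 : j = t
    · simp [h3, dyadProb_self]
    exact absurd ⟨h1, h2, h3⟩ h

lemma eta_eq_sum (Θ : Param n) (a b c : Fin 2) (i t : Fin n) :
    eta Θ a b c i t = 1 / (n : ℝ) * ∑ j,
      (1 / mu Θ a b c t * (dyadProb Θ c a t j * dyadProb Θ c b i j)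
        + 1 / mu Θ a b c i * (dyadProb Θ c a j i * dyadProb Θ c b j t)
        - 1 / mu Θ b a c j * (dyadProb Θ c b i j * dyadProb Θ c b j t)) := by
  unfold eta
  rw [Finset.sum_filter]
  congr 1
  refine Finset.sum_congr rfl fun j _ => ?_
  split_ifs with h
  · rfl
  · by_cases h1 : j = i
    · simp [h1, dyadProb_self]
    by_cases h2 : j = t
    · simp [h2, dyadProb_self]
    exact absurd ⟨h1, h2⟩ h

/-- The sum over the centres `t` of the weighted means of `f i t j` over the pairs `i, j`, with
weights proportional to `p_{it}^{ca} p_{ij}^{cb} p_{tj}^{ca}`. -/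
def tripleMean (Θ : Param n) (a b c : Fin 2) (f : Fin n → Fin n → Fin n → ℝ) : ℝ :=
  ∑ t, ∑ i, ∑ j, 1 / mu Θ a b c t *
    (dyadProb Θ c a i t * dyadProb Θ c b i j * dyadProb Θ c a t j) * f i t j

/-- Swapping `a` and `b` multiplies the weights by a factor that depends on the centre `t` only, and
normalization by `μ_t` cancels it. -/
lemma tripleMean_swap (Θ : Param n) (c : Fin 2) (f : Fin n → Fin n → Fin n → ℝ) :
    tripleMean Θ 1 0 c f = tripleMean Θ 0 1 c f := by
  unfold tripleMean
  refine Finset.sum_congr rfl fun t _ => Finset.sum_congr rfl fun i _ =>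
    Finset.sum_congr rfl fun j _ => ?_
  congr 1
  have h := dyadProb_triple_ratio Θ c t t i j
  have hm : mu Θ 1 0 c t = Real.exp (((c : ℕ) : ℝ) * Θ.rho + Θ.theta + Θ.alpha t + Θ.beta t) *
      mu Θ 0 1 c t := by
    rw [mu_eq_countMean, mu_eq_countMean, countMean_ratio]; ring
  rw [h, hm]
  have he := (Real.exp_pos (((c : ℕ) : ℝ) * Θ.rho + Θ.theta + Θ.alpha t + Θ.beta t)).ne'
  rw [one_div, mul_inv, one_div]
  field_simp

lemma tripleMean_add (Θ : Param n) (a b c : Fin 2) (f f' : Fin n → Fin n → Fin n → ℝ) :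
    tripleMean Θ a b c (fun i t j => f i t j + f' i t j) =
      tripleMean Θ a b c f + tripleMean Θ a b c f' := by
  simp only [tripleMean, mul_add, Finset.sum_add_distrib]

lemma tripleMean_sub (Θ : Param n) (a b c : Fin 2) (f f' : Fin n → Fin n → Fin n → ℝ) :
    tripleMean Θ a b c (fun i t j => f i t j - f' i t j) =
      tripleMean Θ a b c f - tripleMean Θ a b c f' := by
  simp only [tripleMean, mul_sub, Finset.sum_sub_distrib]

lemma tripleMean_one {Θ : Param n} {C : ℝ} (hΘ : Θ.BoundedBy C) (hn : 6 ≤ n) (a b c : Fin 2) :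
    tripleMean Θ a b c (fun _ _ _ => 1) = (n : ℝ) ^ 3 := by
  have hn0 : (n : ℝ) ≠ 0 := by exact_mod_cast (by omega : n ≠ 0)
  have : ∀ t, ∑ i, ∑ j, 1 / mu Θ a b c t *
      (dyadProb Θ c a i t * dyadProb Θ c b i j * dyadProb Θ c a t j) * 1 = (n : ℝ) ^ 2 := by
    intro t
    have hm : mu Θ a b c t ≠ 0 := by
      have := mu_ge hΘ hn a b c t
      have := minProb_pos C
      have : 0 < mu Θ a b c t := lt_of_lt_of_le (by positivity) (mu_ge hΘ hn a b c t)
      exact this.ne'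
    simp only [mul_one, ← Finset.mul_sum]
    rw [one_div, inv_mul_eq_div, div_eq_iff hm, mu_eq_sum]
    field_simp
  unfold tripleMean
  simp only [this]
  simp
  ring

/-- The three terms of `η` record the role of the pair `(i, t)` in a triple: first edge, third edge,
or middle edge of a triple with `a` and `b` exchanged. Reindexing by the centre of the triple gives
the triple means. -/
lemma sum_eta_mul (Θ : Param n) (a b c : Fin 2) (q : Fin n → Fin n → ℝ) :
    ∑ i, ∑ t, eta Θ a b c i t * dyadProb Θ c a i t * q i t =
      1 / (n : ℝ) * (tripleMean Θ a b c (fun i t j => q i t + q t j) -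
        tripleMean Θ b a c (fun i _ j => q i j)) := by
  have e : ∀ i t, eta Θ a b c i t * dyadProb Θ c a i t * q i t = 1 / (n : ℝ) *
      (∑ j, 1 / mu Θ a b c t * (dyadProb Θ c a i t * dyadProb Θ c b i j * dyadProb Θ c a t j) *
          q i t
        + ∑ j, 1 / mu Θ a b c i * (dyadProb Θ c a j i * dyadProb Θ c b j t * dyadProb Θ c a i t) *
          q i t
        - ∑ j, 1 / mu Θ b a c j * (dyadProb Θ c b i j * dyadProb Θ c a i t * dyadProb Θ c b j t) *
          q i t) := by
    intro i t
    rw [eta_eq_sum, ← Finset.sum_add_distrib, ← Finset.sum_sub_distrib, mul_assoc, mul_assoc,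
      Finset.sum_mul]
    congr 1
    exact Finset.sum_congr rfl fun j _ => by ring
  simp only [e, ← Finset.mul_sum, Finset.sum_sub_distrib, Finset.sum_add_distrib]
  rw [tripleMean_add]
  unfold tripleMean
  refine congrArg₂ (· * ·) rfl (congrArg₂ (· - ·) (congrArg₂ (· + ·) ?_ ?_) ?_)
  · exact Finset.sum_comm
  · exact Finset.sum_congr rfl fun t _ => Finset.sum_comm
  · exact (Finset.sum_congr rfl fun i _ => Finset.sum_comm).trans Finset.sum_comm

lemma sum_lt_symm (f : Fin n → Fin n → ℝ) (h0 : ∀ t, f t t = 0) :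
    ∑ t : Fin n, ∑ i ∈ Finset.univ.filter (fun i => t < i), (f i t + f t i) =
      ∑ i, ∑ t, f i t := by
  have h1 : ∀ i t, f i t = (if t < i then f i t else 0) + (if i < t then f i t else 0) := by
    intro i t
    rcases lt_trichotomy i t with h | h | h
    · simp [h, h.not_gt]
    · simp [h, h0]
    · simp [h, h.not_gt]
  simp only [Finset.sum_filter, Finset.sum_add_distrib]
  rw [Finset.sum_comm]
  simp only [← Finset.sum_add_distrib, ← h1]

/-- Here `g x y` is the variance of `x` under the distribution `y`, and the left side is the squared
covariance of `x` with the indicator of outcome 2. In the application that outcome is the reciprocal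
dyad `(1, 1)`, whose indicator is, once centred, the score of `ρ`. -/
lemma sq_le_g {x y : Fin 4 → ℝ} (hy : ∀ k, 0 ≤ y k) (hsum : ∑ k, y k = 1) :
    (x 2 * y 2 - y 2 * ∑ k, x k * y k) ^ 2 ≤ g x y := by
  set m := ∑ k, x k * y k with hm
  have hg : g x y = ∑ k, y k * (x k - m) ^ 2 := by
    have : ∀ k, y k * (x k - m) ^ 2 = x k ^ 2 * y k - 2 * m * (x k * y k) + m ^ 2 * y k :=
      fun k => by ring
    simp only [this, Finset.sum_add_distrib, Finset.sum_sub_distrib, ← Finset.mul_sum, hsum, ← hm]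
    unfold g
    rw [← hm]
    ring
  have h1 : y 2 ≤ 1 := hsum ▸ Finset.single_le_sum (fun k _ => hy k) (Finset.mem_univ 2)
  have h2 : y 2 * (x 2 - m) ^ 2 ≤ ∑ k, y k * (x k - m) ^ 2 :=
    Finset.single_le_sum (f := fun k => y k * (x k - m) ^ 2)
      (fun k _ => mul_nonneg (hy k) (sq_nonneg _)) (Finset.mem_univ 2)
  rw [hg]
  refine le_trans ?_ h2
  have : (x 2 * y 2 - y 2 * m) ^ 2 = y 2 * (y 2 * (x 2 - m) ^ 2) := by ring
  rw [this]
  exact mul_le_of_le_one_left (mul_nonneg (hy 2) (sq_nonneg _)) h1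

/-- One half of the covariance between the linearized dyad contribution and the score of `ρ`. -/
def scoreCov (Θ : Param n) (i t : Fin n) : ℝ :=
  eta Θ 1 0 1 i t * dyadProb Θ 1 1 i t * (1 - dyadProb Θ 1 1 i t) +
    eta Θ 1 0 0 i t * dyadProb Θ 0 1 i t * dyadProb Θ 1 1 i t +
    eta Θ 0 1 1 i t * dyadProb Θ 1 0 i t * dyadProb Θ 1 1 i t -
    eta Θ 0 1 0 i t * dyadProb Θ 0 0 i t * dyadProb Θ 1 1 i t

/-- All triple means of `p^{11}` cancel by `tripleMean_swap`. Only the constant 1 in `1 - p^{11}`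
survives, contributing `(2n³ - n³)/n`. -/
lemma sum_scoreCov {Θ : Param n} {C : ℝ} (hΘ : Θ.BoundedBy C) (hn : 6 ≤ n) :
    ∑ i, ∑ t, scoreCov Θ i t = (n : ℝ) ^ 2 := by
  have hn0 : (n : ℝ) ≠ 0 := by exact_mod_cast (by omega : n ≠ 0)
  simp only [scoreCov, Finset.sum_add_distrib, Finset.sum_sub_distrib]
  rw [sum_eta_mul Θ 1 0 1 (fun i t => 1 - dyadProb Θ 1 1 i t),
    sum_eta_mul Θ 1 0 0 (fun i t => dyadProb Θ 1 1 i t),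
    sum_eta_mul Θ 0 1 1 (fun i t => dyadProb Θ 1 1 i t),
    sum_eta_mul Θ 0 1 0 (fun i t => dyadProb Θ 1 1 i t)]
  simp only [tripleMean_swap, tripleMean_add, tripleMean_sub, tripleMean_one hΘ hn]
  field_simp
  ring

/-- The rescaled variance `n² σ_ρ²` is bounded away from zero. -/
lemma one_le_sigmaRhoSq {Θ : Param n} {C : ℝ} (hΘ : Θ.BoundedBy C) (hn : 6 ≤ n) :
    1 ≤ (n : ℝ) ^ 2 * sigmaRhoSq Θ := by
  have hn0 : (0 : ℝ) < n := by exact_mod_cast (by omega : 0 < n)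
  -- The tangent bound `s² ≥ 2s - 1` makes the lower bound linear in the covariances, whose sum is
  -- known; it plays the role of Cauchy–Schwarz over the dyads.
  have hterm : ∀ t i : Fin n, t < i → 2 * (scoreCov Θ i t + scoreCov Θ t i) - 1 ≤
      g ![-(eta Θ 1 0 0 i t + eta Θ 0 1 1 t i),
        eta Θ 0 1 0 i t + eta Θ 0 1 0 t i,
        eta Θ 1 0 1 i t + eta Θ 1 0 1 t i,
        -(eta Θ 0 1 1 i t + eta Θ 1 0 0 t i)]
      ![dyadProb Θ 0 1 i t, dyadProb Θ 0 0 i t, dyadProb Θ 1 1 i t, dyadProb Θ 1 0 i t] := by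
    intro t i hti
    refine le_trans ?_ (sq_le_g ?_ ?_)
    · refine le_trans (b := (scoreCov Θ i t + scoreCov Θ t i) ^ 2) (by
        nlinarith [sq_nonneg (scoreCov Θ i t + scoreCov Θ t i - 1)]) (le_of_eq ?_)
      congr 1
      simp only [Fin.sum_univ_four, Matrix.cons_val]
      unfold scoreCov
      rw [dyadProb_swap Θ 0 1 t i, dyadProb_swap Θ 1 0 t i, dyadProb_swap Θ 1 1 t i,
        dyadProb_swap Θ 0 0 t i]
      ring
    · intro k
      fin_cases k <;> exact dyadProb_nonneg _ _ _ _ _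
    · simp only [Fin.sum_univ_four, Matrix.cons_val]
      exact sum_dyadProb Θ hti.ne'
  have hcard : ∑ t : Fin n, ∑ i ∈ Finset.univ.filter (fun i => t < i), (1 : ℝ) ≤ (n : ℝ) ^ 2 := by
    calc ∑ t : Fin n, ∑ i ∈ Finset.univ.filter (fun i => t < i), (1 : ℝ)
        ≤ ∑ t : Fin n, (n : ℝ) := Finset.sum_le_sum fun t _ => by
          rw [Finset.sum_const, nsmul_eq_mul, mul_one]
          exact_mod_cast (by simpa using Finset.card_le_univ (Finset.univ.filter fun i => t < i))
      _ = (n : ℝ) ^ 2 := by simp [sq]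
  -- The covariances contribute `2n²`, and the pairs cost at most `n²`.
  have hsum : (n : ℝ) ^ 2 ≤ ∑ t : Fin n, ∑ i ∈ Finset.univ.filter (fun i => t < i),
      (2 * (scoreCov Θ i t + scoreCov Θ t i) - 1) := by
    simp only [Finset.sum_sub_distrib, ← Finset.mul_sum]
    rw [sum_lt_symm _ fun t => by simp [scoreCov, dyadProb_self], sum_scoreCov hΘ hn]
    linarith
  unfold sigmaRhoSq
  rw [← mul_assoc, show (n : ℝ) ^ 2 * (1 / (n : ℝ) ^ 4) = ((n : ℝ) ^ 2)⁻¹ by field_simp,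
    inv_mul_eq_div, one_le_div (by positivity)]
  refine hsum.trans (Finset.sum_le_sum fun t _ => Finset.sum_le_sum fun i hi => ?_)
  exact hterm t i (Finset.mem_filter.1 hi).2

end P1Model

/-! ### Conclusion -/

namespace P1Model

lemma exists_rate_le {η : ℝ} (hη : 0 < η) : ∃ N : ℕ, ∀ n : ℕ, N ≤ n →
    √(Real.log n / n) ≤ η := by
  have h1 : Filter.Tendsto (fun n : ℕ => Real.log n / (n : ℝ)) Filter.atTop (nhds 0) :=
    Real.isLittleO_log_id_atTop.tendsto_div_nhds_zero.comp tendsto_natCast_atTop_atTop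
  have h2 : Filter.Tendsto (fun n : ℕ => √(Real.log n / (n : ℝ))) Filter.atTop (nhds 0) := by
    simpa using h1.sqrt
  obtain ⟨N, hN⟩ := Filter.eventually_atTop.1 (h2.eventually (eventually_lt_nhds hη))
  exact ⟨N, fun n hn => (hN n hn).le⟩

lemma Param.BoundedBy.mono {n : ℕ} {Θ : Param n} {C C' : ℝ} (h : Θ.BoundedBy C) (hC : C ≤ C') :
    Θ.BoundedBy C' :=
  ⟨h.1.trans hC, h.2.1.trans hC, fun i => (h.2.2.1 i).trans hC, fun j => (h.2.2.2 j).trans hC⟩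

lemma comparable_of_close {n : ℕ} {Θ Θ' : Param n} {C r : ℝ} (hn : 6 ≤ n) (hr0 : 0 ≤ r)
    (hr : r ≤ 1) (hΘ : Θ.BoundedBy C) (h : Θ'.Close Θ r) : Comparable (C + 1) r Θ' Θ :=
  ⟨hn, hr0, (h.boundedBy hΘ).mono (by linarith), hΘ.mono (by linarith), h⟩

end P1Model

end

open P1Model in
theorem lemma1 (C : ℝ) (hC : 0 < C) :
    -- `σ̂_ρ² / σ_ρ² → 1` in probability as `n → ∞`, uniformly over the parameters bounded by `C`
    (∀ ε : ℝ, 0 < ε → ∀ δ : ℝ, 0 < δ → ∃ N : ℕ, ∀ n : ℕ, N ≤ n →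
      ∀ Θ : P1Model.Param n, Θ.Identified → Θ.BoundedBy C →
      ∀ (Ω : Type*) [MeasurableSpace Ω] (P : Measure Ω) [IsProbabilityMeasure P]
        (X : Ω → Fin n → Fin n → Fin 2), P1Model.IsRandomGraph P X Θ →
        0 < P1Model.sigmaRhoSq Θ ∧
        1 - δ ≤ P.real {ω | P1Model.EstimatorDefined (X ω) ∧
          |P1Model.sigmaRhoSqHat (X ω) / P1Model.sigmaRhoSq Θ - 1| ≤ ε}) ∧
    -- `ρ̂* - ρ* = O(√(log n / n³))` with probability at least `1 - O(1/n)`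
    (∃ K : ℝ, 0 < K ∧ ∃ K' : ℝ, 0 < K' ∧ ∃ N : ℕ, ∀ n : ℕ, N ≤ n →
      ∀ Θ : P1Model.Param n, Θ.Identified → Θ.BoundedBy C →
      ∀ (Ω : Type*) [MeasurableSpace Ω] (P : Measure Ω) [IsProbabilityMeasure P]
        (X : Ω → Fin n → Fin n → Fin 2), P1Model.IsRandomGraph P X Θ →
        1 - K' / (n : ℝ) ≤ P.real {ω | P1Model.EstimatorDefined (X ω) ∧
          |P1Model.rhoStarHat (X ω) - P1Model.rhoStar Θ|
            ≤ K * Real.sqrt (Real.log (n : ℝ) / (n : ℝ) ^ 3)}) := by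
  have hR := rateConst_pos C
  obtain ⟨N₁, hN₁⟩ := exists_rate_le (η := 1 / rateConst C) (by positivity)
  have hrate : ∀ n, N₁ ≤ n → rateConst C * √(Real.log n / n) ≤ 1 := fun n hn => by
    have := hN₁ n hn
    rw [le_div_iff₀ hR] at this
    linarith
  constructor
  · intro ε hε δ hδ
    -- For large `n` the estimator is within distance 1 of `Θ`, hence bounded by `C + 1`.
    obtain ⟨B, hB⟩ := exists_near_sigmaRhoSq (C + 1)
    have hB1 : 0 < |B| + 1 := by positivity
    obtain ⟨N₂, hN₂⟩ := exists_rate_le (η := ε / ((|B| + 1) * rateConst C)) (by positivity)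
    refine ⟨max (max N₁ N₂) (max 6 ⌈32 / δ⌉₊), fun n hn Θ hid hΘ Ω _ P _ X hX => ?_⟩
    simp only [max_le_iff] at hn
    obtain ⟨⟨hn₁, hn₂⟩, hn₆, hnδ⟩ := hn
    have hn0 : (0 : ℝ) < n := by exact_mod_cast (by omega : 0 < n)
    have hone := one_le_sigmaRhoSq hΘ hn₆
    have hpos : 0 < sigmaRhoSq Θ := by
      by_contra hcon
      have := mul_nonpos_of_nonneg_of_nonpos (sq_nonneg (n : ℝ)) (not_lt.1 hcon)
      linarith
    refine ⟨hpos, le_trans ?_ ((hX.estimator_rate hn₆ hid hΘ (hrate n hn₁)).trans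
      (measureReal_mono fun ω hω => ⟨hω.1, ?_⟩))⟩
    · have : 32 / δ ≤ n := Nat.ceil_le.1 hnδ
      have : 32 / (n : ℝ) ≤ δ := by
        rw [div_le_iff₀ hδ] at this
        rw [div_le_iff₀ hn0]
        linarith
      linarith
    · have h := (hB n _ _ _ (comparable_of_close hn₆ (by positivity) (hrate n hn₁) hΘ hω.2)).2.2.2
      -- After rescaling by `n²` the denominator is at least 1, so the Lipschitz bound on the
      -- numerator controls the relative error.
      have e : sigmaRhoSqHat (X ω) / sigmaRhoSq Θ - 1 =
          ((n : ℝ) ^ 2 * sigmaRhoSq (estimator (X ω)) - (n : ℝ) ^ 2 * sigmaRhoSq Θ) /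
            ((n : ℝ) ^ 2 * sigmaRhoSq Θ) := by
        unfold sigmaRhoSqHat
        field_simp
      rw [e, abs_div, abs_of_pos (by positivity : 0 < (n : ℝ) ^ 2 * sigmaRhoSq Θ),
        div_le_iff₀ (by positivity)]
      have h2 := hN₂ n hn₂
      rw [le_div_iff₀ (by positivity)] at h2
      have h3 : B * (rateConst C * √(Real.log n / n)) ≤
          (|B| + 1) * (rateConst C * √(Real.log n / n)) := by
        gcongr
        linarith [le_abs_self B]
      nlinarith
  · obtain ⟨B, hB⟩ := exists_near_rhoStar (C + 1)
    have hB1 : 0 < |B| + 1 := by positivity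
    refine ⟨(|B| + 1) * rateConst C, by positivity, 32, by norm_num, max N₁ 6,
      fun n hn Θ hid hΘ Ω _ P _ X hX => ?_⟩
    simp only [max_le_iff] at hn
    obtain ⟨hn₁, hn₆⟩ := hn
    have hn0 : (0 : ℝ) < n := by exact_mod_cast (by omega : 0 < n)
    refine (hX.estimator_rate hn₆ hid hΘ (hrate n hn₁)).trans
      (measureReal_mono fun ω hω => ⟨hω.1, ?_⟩)
    have h := (hB n _ _ _ (comparable_of_close hn₆ (by positivity) (hrate n hn₁) hΘ hω.2)).2.2.2
    rw [← mul_sub, abs_mul, abs_of_pos hn0] at h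
    -- The Lipschitz bound concerns `n ρ*`; removing the factor `n` turns `√(log n / n)` into the
    -- claimed rate.
    have e : √(Real.log n / (n : ℝ) ^ 3) = √(Real.log n / n) / n := by
      rw [show Real.log n / (n : ℝ) ^ 3 = Real.log n / n / (n : ℝ) ^ 2 by field_simp,
        Real.sqrt_div' _ (by positivity), Real.sqrt_sq hn0.le]
    rw [e, ← mul_div_assoc, le_div_iff₀ hn0]
    have h3 : B * (rateConst C * √(Real.log n / n)) ≤
        (|B| + 1) * (rateConst C * √(Real.log n / n)) := by
      gcongr
      linarith [le_abs_self B]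
    unfold rhoStarHat
    linarith
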